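/- Let $G$ be a real Banach–Lie group with Banach–Lie algebra $\mathfrak g=T_1G$ (bracket defined by left-invariant vector fields), and let $K\subset G$ be an embedded Banach–Lie subgroup: $K$ with the subspace topology is a Banach–Lie group, and the inclusion $\iota:K\to G$ is smooth with everywhere injective differential of closed range. Let $\mathfrak k=\iota_{*1}(T_1K)\subset\mathfrak g$; it is not assumed to be complemented. Assume that the quotient space $G/K$ carries the structure of a smooth Hausdorff Banach manifold for which $\pi:G\to G/K$, $\pi(g)=gK$, is a submersion (smooth with everywhere surjective differential). For $g\in G$ let $\alpha_g:G/K\to G/K$, $\alpha_g(\pi(h))=\pi(gh)$, and let $\mathrm{Ad}_g:\mathfrak g\to\mathfrak g$ be the differential at $1$ of $h\mapsto ghg^{-1}$. Put $p_0=\pi(1)$. Let $\mathcal I:\mathfrak g\to\mathfrak g$ be a bounded linear operator that is admissible, i.e. $\mathcal I\mathfrak k\subset\mathfrak k$ and $(\mathrm{Ad}_k\mathcal I-\mathcal I\,\mathrm{Ad}_k)\mathfrak g\subset\mathfrak k$ for all $k\in K$. Then there is exactly one smooth vector bundle map $\mathcal N:T(G/K)\to T(G/K)$ covering the identity that is homogeneous,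 i.e. $(\alpha_g)_*\mathcal N_p=\mathcal N_{\alpha_g(p)}(\alpha_g)_*$ for all $g\in G$ and $p\in G/K$, and satisfies $\mathcal N_{p_0}\pi_{*1}v=\pi_{*1}\mathcal I v$ for all $v\in\mathfrak g$. For smooth vector fields $X,Y$ on $G/K$ let $$\Omega_{\mathcal N}(X,Y)=\mathcal N[\mathcal NX,Y]+\mathcal N[X,\mathcal NY]-[\mathcal NX,\mathcal NY]-\mathcal N^2[X,Y]$$ be the Nijenhuis torsion of $\mathcal N$. 1. If $X,Y$ are smooth vector fields on $G/K$, $g\in G$, $p=\pi(g)$, and $v,w\in\mathfrak g$ are such that $X(p)=(\alpha_g)_*\pi_{*1}v$ and $Y(p)=(\alpha_g)_*\pi_{*1}w$, then $$\Omega_{\mathcal N}(X,Y)(p)=(\alpha_g)_*\pi_{*1}\big(\mathcal I[v,\mathcal Iw]+\mathcal I[\mathcal Iv,w]-[\mathcal Iv,\mathcal Iw]-\mathcal I^2[v,w]\big).$$ 2. $\mathcal N$ is a Nijenhuis operator, i.e. $\Omega_{\mathcal N}(X,Y)=0$ for all smooth vector fields $X,Y$ on $G/K$, if and only if $$\mathcal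 I[v,\mathcal Iw]+\mathcal I[\mathcal Iv,w]-[\mathcal Iv,\mathcal Iw]-\mathcal I^2[v,w]\in\mathfrak k\qquad\text{for all }v,w\in\mathfrak g.$$ -/

import Mathlib

open scoped Manifold ContDiff

namespace BanachHomogeneous

/-! ### Immersions and submersions between Banach manifolds

The kernel of the differential of a submersion, and the range of the differential of an immersion,
need not be complemented, so Mathlib's split notions are not the right ones here. -/

section Maps

variable (E E' : Type*) {M M' : Type*}
  [NormedAddCommGroup E] [NormedSpace ℝ E] [TopologicalSpace M] [ChartedSpace E M]
  [NormedAddCommGroup E'] [NormedSpace ℝ E'] [TopologicalSpace M'] [ChartedSpace E' M']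

/-- A smooth map whose differential is everywhere injective with closed range. -/
structure IsImmersion (f : M → M') : Prop where
  smooth : ContMDiff 𝓘(ℝ, E) 𝓘(ℝ, E') ∞ f
  injective : ∀ x, Function.Injective (mfderiv 𝓘(ℝ, E) 𝓘(ℝ, E') f x)
  isClosed_range : ∀ x, IsClosed (Set.range (mfderiv 𝓘(ℝ, E) 𝓘(ℝ, E') f x))

/-- A smooth map whose differential is everywhere surjective. -/
structure IsSubmersion (f : M → M') : Prop where
  smooth : ContMDiff 𝓘(ℝ, E) 𝓘(ℝ, E') ∞ f
  surjective : ∀ x, Function.Surjective (mfderiv 𝓘(ℝ, E) 𝓘(ℝ, E') f x)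

end Maps

/-! ### Vector bundle maps of the tangent bundle and their Nijenhuis torsion -/

section Torsion

variable {E M : Type*} [NormedAddCommGroup E] [NormedSpace ℝ E]
  [TopologicalSpace M] [ChartedSpace E M]

/-- The vector field `X` on `M` is smooth, as a map from `M` to its tangent bundle. -/
def IsSmoothField [IsManifold 𝓘(ℝ, E) 1 M] (X : ∀ p : M, TangentSpace 𝓘(ℝ, E) p) : Prop :=
  ContMDiff 𝓘(ℝ, E) 𝓘(ℝ, E).tangent ∞ (fun p : M => (⟨p, X p⟩ : TangentBundle 𝓘(ℝ, E) M))

/-- The family `N` of bounded linear operators on the tangent spaces (a vector bundle map covering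
the identity) is smooth, as a map from the tangent bundle to itself. -/
def IsSmoothBundleMap [IsManifold 𝓘(ℝ, E) 1 M]
    (N : ∀ p : M, TangentSpace 𝓘(ℝ, E) p →L[ℝ] TangentSpace 𝓘(ℝ, E) p) : Prop :=
  ContMDiff 𝓘(ℝ, E).tangent 𝓘(ℝ, E).tangent ∞
    (fun ξ : TangentBundle 𝓘(ℝ, E) M => (⟨ξ.1, N ξ.1 ξ.2⟩ : TangentBundle 𝓘(ℝ, E) M))

/-- The Nijenhuis torsion `N[NX,Y] + N[X,NY] - [NX,NY] - N²[X,Y]`. -/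
noncomputable def nijenhuisTorsion
    (N : ∀ p : M, TangentSpace 𝓘(ℝ, E) p →L[ℝ] TangentSpace 𝓘(ℝ, E) p)
    (X Y : ∀ p : M, TangentSpace 𝓘(ℝ, E) p) (p : M) : TangentSpace 𝓘(ℝ, E) p :=
  N p (VectorField.mlieBracket 𝓘(ℝ, E) (fun q => N q (X q)) Y p)
    + N p (VectorField.mlieBracket 𝓘(ℝ, E) X (fun q => N q (Y q)) p)
    - VectorField.mlieBracket 𝓘(ℝ, E) (fun q => N q (X q)) (fun q => N q (Y q)) p
    - N p (N p (VectorField.mlieBracket 𝓘(ℝ, E) X Y p))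

/-- `N` is a Nijenhuis operator: its torsion vanishes on all pairs of smooth vector fields. -/
def IsNijenhuis [IsManifold 𝓘(ℝ, E) 1 M]
    (N : ∀ p : M, TangentSpace 𝓘(ℝ, E) p →L[ℝ] TangentSpace 𝓘(ℝ, E) p) : Prop :=
  ∀ X Y : ∀ p : M, TangentSpace 𝓘(ℝ, E) p, IsSmoothField X → IsSmoothField Y →
    ∀ p, nijenhuisTorsion N X Y p = 0

end Torsion

/-! ### Banach-Lie groups, subgroups and homogeneous spaces -/

section Homogeneous

variable {E : Type*} (F : Type*) {E' G : Type*}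
  [NormedAddCommGroup E] [NormedSpace ℝ E]
  [NormedAddCommGroup F] [NormedSpace ℝ F]
  [NormedAddCommGroup E'] [NormedSpace ℝ E']
  [Group G] [TopologicalSpace G] [ChartedSpace E G]

/-- The adjoint map `Ad_g`: the differential at `1` of the conjugation `h ↦ g h g⁻¹`. -/
noncomputable def Ad (g : G) : GroupLieAlgebra 𝓘(ℝ, E) G →L[ℝ] GroupLieAlgebra 𝓘(ℝ, E) G :=
  mfderiv 𝓘(ℝ, E) 𝓘(ℝ, E) (fun h : G => g * h * g⁻¹) 1

/-- The Lie algebra of a subgroup `K` (with a manifold structure on `K`) as a subspace of the Lie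
algebra of `G`: the range of the differential at `1` of the inclusion. -/
noncomputable def lieSubalgebra (K : Subgroup G) [ChartedSpace F K] :
    Submodule ℝ (GroupLieAlgebra 𝓘(ℝ, E) G) :=
  (mfderiv 𝓘(ℝ, F) 𝓘(ℝ, E) (Subtype.val : K → G) 1).range

/-- The bounded operator `A` on the Lie algebra `𝔤` of `G` is admissible for `K`: it maps `𝔨` into
`𝔨`, and `Ad_k A - A Ad_k` has range in `𝔨` for all `k` in `K`. -/
structure IsAdmissible (K : Subgroup G) [ChartedSpace F K]
    (A : GroupLieAlgebra 𝓘(ℝ, E) G →L[ℝ] GroupLieAlgebra 𝓘(ℝ, E) G) : Prop where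
  map_mem : ∀ v ∈ lieSubalgebra (E := E) F K, A v ∈ lieSubalgebra (E := E) F K
  commute : ∀ k ∈ K, ∀ v : GroupLieAlgebra 𝓘(ℝ, E) G,
    Ad k (A v) - A (Ad k v) ∈ lieSubalgebra (E := E) F K

variable (K : Subgroup G) [ChartedSpace E' (G ⧸ K)]

/-- The differential at `1` of the quotient map `π : G → G/K`. -/
noncomputable def projDeriv :
    GroupLieAlgebra 𝓘(ℝ, E) G →L[ℝ] TangentSpace 𝓘(ℝ, E') ((1 : G) : G ⧸ K) :=
  mfderiv 𝓘(ℝ, E) 𝓘(ℝ, E') (fun h : G => (h : G ⧸ K)) 1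

variable {K} in
/-- The differential at `p` of the diffeomorphism `α_g : q ↦ g • q` of `G/K`. -/
noncomputable def actDeriv (g : G) (p : G ⧸ K) :
    TangentSpace 𝓘(ℝ, E') p →L[ℝ] TangentSpace 𝓘(ℝ, E') (g • p) :=
  mfderiv 𝓘(ℝ, E') 𝓘(ℝ, E') (fun q : G ⧸ K => g • q) p

/-- The map `(α_g)_* π_{*1}` from `𝔤` to the tangent space at `π(g) = α_g(π(1))`. -/
noncomputable def transport (g : G) :
    GroupLieAlgebra 𝓘(ℝ, E) G →L[ℝ] TangentSpace 𝓘(ℝ, E') (g : G ⧸ K) :=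
  (actDeriv g ((1 : G) : G ⧸ K)).comp (projDeriv K)

variable {K}

/-- `N` is a homogeneous vector bundle map of `T(G/K)`: it is smooth and invariant under all the
automorphisms `α_g`. -/
structure IsHomogeneous [IsManifold 𝓘(ℝ, E') 1 (G ⧸ K)]
    (N : ∀ p : G ⧸ K, TangentSpace 𝓘(ℝ, E') p →L[ℝ] TangentSpace 𝓘(ℝ, E') p) : Prop where
  smooth : IsSmoothBundleMap N
  invariant : ∀ (g : G) (p : G ⧸ K) (ξ : TangentSpace 𝓘(ℝ, E') p),
    actDeriv g p (N p ξ) = N (g • p) (actDeriv g p ξ)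

/-- `N` is the homogeneous vector bundle map induced by the operator `A` on `𝔤`: at the base point
`p₀ = π(1)` it is given by `N_{p₀} π_{*1} v = π_{*1} A v`, and then it is `(α_g)_* N_{p₀} (α_g)_*⁻¹`
at `α_g(p₀)` by homogeneity. -/
structure IsInducedBy [IsManifold 𝓘(ℝ, E') 1 (G ⧸ K)]
    (N : ∀ p : G ⧸ K, TangentSpace 𝓘(ℝ, E') p →L[ℝ] TangentSpace 𝓘(ℝ, E') p)
    (A : GroupLieAlgebra 𝓘(ℝ, E) G →L[ℝ] GroupLieAlgebra 𝓘(ℝ, E) G) : Prop where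
  homogeneous : IsHomogeneous N
  base : ∀ v : GroupLieAlgebra 𝓘(ℝ, E) G,
    N ((1 : G) : G ⧸ K) (projDeriv K v) = projDeriv K (A v)

/-- The Nijenhuis torsion `A[v,Aw] + A[Av,w] - [Av,Aw] - A²[v,w]` of an operator `A` on `𝔤`. -/
noncomputable def lieTorsion
    (A : GroupLieAlgebra 𝓘(ℝ, E) G →L[ℝ] GroupLieAlgebra 𝓘(ℝ, E) G)
    (v w : GroupLieAlgebra 𝓘(ℝ, E) G) : GroupLieAlgebra 𝓘(ℝ, E) G :=
  A ⁅v, A w⁆ + A ⁅A v, w⁆ - ⁅A v, A w⁆ - A (A ⁅v, w⁆)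

end Homogeneous

end BanachHomogeneous

open BanachHomogeneous

/-! Write `Q_g = (α_g)_* π_{*1}` (`transport K g`); it maps `𝔤` onto the tangent space at `gK`.
Being induced by `A` amounts to `N Q_g = Q_g A` for all `g` (`isInducedBy_iff_transport`). Since
every `Q_g` is onto, this gives uniqueness. For existence, `ker Q_g = 𝔨` (`mem_lieSubalgebra_iff`),
so `A𝔨 ⊆ 𝔨` lets `Q_g A` factor through `Q_g`; and `Q_{gk} = Q_g Ad_k` for `k ∈ K`, so the
commutation condition makes the factor independent of the representative `g`.

The analytic difficulty is smoothness: `ker π_*` need not be complemented, so `π` need not have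
smooth local sections. Instead, Graves' theorem supplies solutions of `P x' = y` with `‖x' - x‖` at
most a constant times `‖y - P x‖`. This suffices to differentiate functions downstairs whose
pullbacks are differentiable, and an induction on the order gives smoothness
(`contDiffAt_of_clm_apply_comp_eq`). It applies to `N` because `N Q_g = Q_g A` has a smooth
right-hand side and precomposition with a surjection is bounded below. The same estimate produces
curves in the fibre `K` and so gives `ker π_{*1} ⊆ 𝔨`.

For the torsion, `A` extends to a left-invariant operator on `G` that is `π`-related to `N`. Torsion
is tensorial and natural under maps intertwining the operators (`nijenhuisTorsion_natural`), so it
can be computed upstairs on left-invariant fields, where it is `lieTorsion A`. It vanishes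
downstairs exactly when `lieTorsion A` takes values in `ker Q_g = 𝔨`. -/

namespace BanachHomogeneous

open Filter Topology Asymptotics Set

/-! ### Calculus of maps with surjective differential between Banach spaces -/

section Calculus

/-- Metric regularity: near a point where the strict derivative is onto, the equation `P x' = y`
has solutions at distance from `x` controlled by `‖y - P x‖`. -/
theorem exists_preimage_near {E E' : Type*} [NormedAddCommGroup E] [NormedSpace ℝ E]
    [CompleteSpace E] [NormedAddCommGroup E'] [NormedSpace ℝ E'] [CompleteSpace E']
    {P : E → E'} {P' : E →L[ℝ] E'} {x₀ : E} (hP : HasStrictFDerivAt P P' x₀)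
    (hs : Function.Surjective P') :
    ∃ C : ℝ, 0 < C ∧ ∀ᶠ p : E × E' in 𝓝 (x₀, P x₀),
      ∃ x', P x' = p.2 ∧ ‖x' - p.1‖ ≤ C * ‖p.2 - P p.1‖ := by
  have hr : P'.range = ⊤ := LinearMap.range_eq_top.2 hs
  set g := P'.nonlinearRightInverseOfSurjective hr
  have hg : 0 < g.nnnorm := P'.nonlinearRightInverseOfSurjective_nnnorm_pos hr
  -- With approximation constant `1/(2‖g‖)`, the image of a ball of radius `ε` covers a ball of
  -- radius `(1/‖g‖ - 1/(2‖g‖)) ε = ε/(2‖g‖)`. Hence the constant `2‖g‖` below.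
  obtain ⟨s, hs, hA⟩ := hP.approximates_deriv_on_nhds (c := g.nnnorm⁻¹ / 2)
    (Or.inr (by positivity))
  obtain ⟨r, hr0, hr⟩ := Metric.mem_nhds_iff.1 hs
  have hg' : (0 : ℝ) < g.nnnorm := hg
  refine ⟨2 * g.nnnorm, by positivity, ?_⟩
  have h1 : ∀ᶠ p : E × E' in 𝓝 (x₀, P x₀), p.1 ∈ Metric.ball x₀ (r / 2) :=
    continuousAt_fst (Metric.ball_mem_nhds _ (by positivity))
  have hc : ContinuousAt (fun p : E × E' => 2 * (g.nnnorm : ℝ) * ‖p.2 - P p.1‖) (x₀, P x₀) := by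
    have : ContinuousAt (fun p : E × E' => P p.1) (x₀, P x₀) :=
      ContinuousAt.comp (f := Prod.fst) (g := P) hP.continuousAt continuousAt_fst
    exact continuousAt_const.mul (continuousAt_snd.sub this).norm
  have h2 : ∀ᶠ p : E × E' in 𝓝 (x₀, P x₀), 2 * (g.nnnorm : ℝ) * ‖p.2 - P p.1‖ < r / 2 :=
    hc.eventually (gt_mem_nhds (by simp; positivity))
  filter_upwards [h1, h2] with p hp1 hp2
  have hsub : Metric.closedBall p.1 (2 * (g.nnnorm : ℝ) * ‖p.2 - P p.1‖) ⊆ s := by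
    intro z hz
    apply hr
    rw [Metric.mem_ball] at hp1 ⊢
    rw [Metric.mem_closedBall] at hz
    linarith [dist_triangle z p.1 x₀]
  have hS := hA.surjOn_closedBall_of_nonlinearRightInverse g (by positivity) hsub
  obtain ⟨x', hx', hx''⟩ := hS (a := p.2) (by
    rw [Metric.mem_closedBall, dist_eq_norm]
    apply le_of_eq
    push_cast
    field_simp
    ring)
  exact ⟨x', hx'', by rwa [Metric.mem_closedBall, dist_eq_norm] at hx'⟩

/-- A bounded operator vanishing on the kernel of a bounded surjection factors through it. -/
theorem exists_comp_eq_of_ker_le {E E' X : Type*} [NormedAddCommGroup E] [NormedSpace ℝ E]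
    [CompleteSpace E] [NormedAddCommGroup E'] [NormedSpace ℝ E'] [CompleteSpace E']
    [NormedAddCommGroup X] [NormedSpace ℝ X] {Q : E →L[ℝ] E'} (hQ : Function.Surjective Q)
    (S : E →L[ℝ] X) (hS : ∀ h, Q h = 0 → S h = 0) :
    ∃ T : E' →L[ℝ] X, ∀ h, T (Q h) = S h := by
  obtain ⟨C, hC, g⟩ := Q.exists_preimage_norm_le hQ
  choose g hg hgC using g
  -- The chosen preimage `g` is not linear, but `S` is constant on the fibres of `Q`, so `S ∘ g` is.
  have key : ∀ a b, Q a = Q b → S a = S b := fun a b hab => by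
    rw [← sub_eq_zero, ← map_sub]; exact hS _ (by simp [hab])
  let T : E' →ₗ[ℝ] X :=
    { toFun := fun y => S (g y)
      map_add' := fun a b => by
        rw [← map_add]; exact key _ _ (by simp [hg])
      map_smul' := fun c a => by
        simp only [RingHom.id_apply]
        rw [← map_smul]; exact key _ _ (by simp [hg]) }
  refine ⟨T.mkContinuous (‖S‖ * C) fun y => ?_, fun h => key _ _ (hg _)⟩
  calc ‖S (g y)‖ ≤ ‖S‖ * ‖g y‖ := S.le_opNorm _
    _ ≤ ‖S‖ * (C * ‖y‖) := by gcongr; exact hgC y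
    _ = _ := by ring

/-- Lyusternik: every vector in the kernel of a surjective strict derivative is tangent to a curve
in the fibre. -/
theorem exists_curve_in_fiber {E E' : Type*} [NormedAddCommGroup E] [NormedSpace ℝ E]
    [CompleteSpace E] [NormedAddCommGroup E'] [NormedSpace ℝ E'] [CompleteSpace E']
    {P : E → E'} {P' : E →L[ℝ] E'} {x₀ : E} (hP : HasStrictFDerivAt P P' x₀)
    (hs : Function.Surjective P') {h : E} (hh : P' h = 0) :
    ∃ c : ℝ → E, (∀ᶠ t in 𝓝 (0 : ℝ), P (c t) = P x₀) ∧
      (fun t => c t - x₀ - t • h) =o[𝓝 0] (fun t : ℝ => t) := by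
  obtain ⟨C, hC, hreg⟩ := exists_preimage_near hP hs
  have hline : HasDerivAt (fun t : ℝ => x₀ + t • h) h 0 := by
    simpa using ((hasDerivAt_id (0 : ℝ)).smul_const h).const_add x₀
  have htend : Tendsto (fun t : ℝ => (x₀ + t • h, P x₀)) (𝓝 0) (𝓝 (x₀, P x₀)) := by
    have := hline.continuousAt.tendsto
    simp only [zero_smul, add_zero] at this
    exact this.prodMk_nhds tendsto_const_nhds
  have hev := htend.eventually hreg
  simp only at hev
  classical
  -- `c t` corrects the point `x₀ + t • h` onto the fibre. The correction is bounded by `‖P x₀ - P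
  -- (x₀ + t • h)‖`, which is `o(t)` because `P' h = 0`.
  let c : ℝ → E := fun t => if H : ∃ x', P x' = P x₀ ∧
    ‖x' - (x₀ + t • h)‖ ≤ C * ‖P x₀ - P (x₀ + t • h)‖ then H.choose else x₀
  have hc : ∀ᶠ t in 𝓝 (0 : ℝ), P (c t) = P x₀ ∧
      ‖c t - (x₀ + t • h)‖ ≤ C * ‖P x₀ - P (x₀ + t • h)‖ := by
    filter_upwards [hev] with t ht
    simp only [c, dif_pos ht]
    exact ht.choose_spec
  refine ⟨c, hc.mono fun t ht => ht.1, ?_⟩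
  have hPd : HasDerivAt (fun t : ℝ => P (x₀ + t • h)) (P' h) 0 := by
    refine HasFDerivAt.comp_hasDerivAt (l := P) (0 : ℝ) ?_ hline
    simpa using hP.hasFDerivAt
  have ho : (fun t : ℝ => P (x₀ + t • h) - P x₀) =o[𝓝 0] (fun t : ℝ => t) := by
    simpa [hh] using hPd.isLittleO
  refine IsBigO.trans_isLittleO (IsBigO.of_bound C ?_) ho
  filter_upwards [hc] with t ht
  rw [norm_sub_rev (P (x₀ + t • h)), sub_sub]
  exact ht.2

end Calculus

/-! ### Descent of continuity and differentiability along maps with surjective derivative -/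

section Descent

theorem antilipschitz_of_norm_le {Z W : Type*} [NormedAddCommGroup Z] [NormedSpace ℝ Z]
    [NormedAddCommGroup W] [NormedSpace ℝ W] {J : Z →L[ℝ] W} {c : ℝ}
    (hc : ∀ z, ‖z‖ ≤ c * ‖J z‖) : AntilipschitzWith (Real.toNNReal c) J := by
  refine AddMonoidHomClass.antilipschitz_of_bound J fun z => (hc z).trans ?_
  gcongr
  exact Real.le_coe_toNNReal c

variable {E E' Z W : Type*}
  [NormedAddCommGroup Z] [NormedSpace ℝ Z] [NormedAddCommGroup W] [NormedSpace ℝ W]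

/-- If `J x (f x) = s x` with `J` and `s` continuous and `J x₀` bounded below, then `f` is
continuous. -/
theorem continuousAt_of_clm_apply_eq [TopologicalSpace E] {J : E → Z →L[ℝ] W} {f : E → Z} {s : E → W} {x₀ : E}
    (hJ : ContinuousAt J x₀) (hs : ContinuousAt s x₀) {c : ℝ} (hc : ∀ z, ‖z‖ ≤ c * ‖J x₀ z‖)
    (h : ∀ᶠ x in 𝓝 x₀, J x (f x) = s x) : ContinuousAt f x₀ := by
  have hc' : ∀ z, ‖z‖ ≤ |c| * ‖J x₀ z‖ := fun z => (hc z).trans (by gcongr; exact le_abs_self c)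
  have hu : Tendsto (fun x => 2 * |c| * ‖s x - J x (f x₀)‖) (𝓝 x₀) (𝓝 0) := by
    have : ContinuousAt (fun x => 2 * |c| * ‖s x - J x (f x₀)‖) x₀ :=
      continuousAt_const.mul (hs.sub (hJ.clm_apply continuousAt_const)).norm
    simpa [ContinuousAt, h.self_of_nhds] using this
  -- In the estimate below, the term with `J x - J x₀` is at most half of `‖f x - f x₀‖` and is
  -- absorbed into the left-hand side.
  have hsmall : ∀ᶠ x in 𝓝 x₀, |c| * ‖J x - J x₀‖ < 1 / 2 := by
    have : ContinuousAt (fun x => |c| * ‖J x - J x₀‖) x₀ :=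
      continuousAt_const.mul (hJ.sub continuousAt_const).norm
    exact this.eventually (gt_mem_nhds (by simp))
  rw [ContinuousAt, tendsto_iff_norm_sub_tendsto_zero]
  refine squeeze_zero' (Eventually.of_forall fun _ => norm_nonneg _) ?_ hu
  filter_upwards [h, hsmall] with x hx hx'
  have e : J x₀ (f x - f x₀) = (s x - J x (f x₀)) - (J x - J x₀) (f x - f x₀) := by
    simp [← hx]
  have h1 := hc' (f x - f x₀)
  have h2 : ‖J x₀ (f x - f x₀)‖ ≤ ‖s x - J x (f x₀)‖ + ‖J x - J x₀‖ * ‖f x - f x₀‖ := by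
    rw [e]
    exact (norm_sub_le _ _).trans (by gcongr; exact ContinuousLinearMap.le_opNorm _ _)
  have h3 : |c| * ‖J x₀ (f x - f x₀)‖ ≤
      |c| * ‖s x - J x (f x₀)‖ + (|c| * ‖J x - J x₀‖) * ‖f x - f x₀‖ := by
    calc _ ≤ |c| * (‖s x - J x (f x₀)‖ + ‖J x - J x₀‖ * ‖f x - f x₀‖) := by gcongr
      _ = _ := by ring
  have h4 : (|c| * ‖J x - J x₀‖) * ‖f x - f x₀‖ ≤ 1 / 2 * ‖f x - f x₀‖ := by gcongr
  linarith

variable [NormedAddCommGroup E] [NormedSpace ℝ E]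

/-- If `J x (f x) = s x` with `J` and `s` differentiable and `J x₀` bounded below, then `f` is
differentiable. -/
theorem exists_hasFDerivAt_of_clm_apply_eq [CompleteSpace Z] [CompleteSpace W] {J : E → Z →L[ℝ] W}
    {J' : E →L[ℝ] Z →L[ℝ] W} {f : E → Z} {s : E → W} {s' : E →L[ℝ] W} {x₀ : E}
    (hJ : HasFDerivAt J J' x₀) (hs : HasFDerivAt s s' x₀) {c : ℝ} (hc : ∀ z, ‖z‖ ≤ c * ‖J x₀ z‖)
    (h : ∀ᶠ x in 𝓝 x₀, J x (f x) = s x) :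
    ∃ B : E →L[ℝ] Z, HasFDerivAt f B x₀ ∧ ∀ v, J x₀ (B v) = s' v - J' v (f x₀) := by
  have hf := continuousAt_of_clm_apply_eq hJ.continuousAt hs.continuousAt hc h
  set L : E →L[ℝ] W := s' - J'.flip (f x₀) with hL
  have hu : HasFDerivAt (fun x => s x - J x (f x₀)) L x₀ := by
    have := hs.fun_sub (hJ.clm_apply (hasFDerivAt_const (f x₀) x₀))
    simpa [hL] using this
  have hcl : IsClosed (range (J x₀)) :=
    (antilipschitz_of_norm_le hc).isClosed_range (J x₀).uniformContinuous
  have hinj : Function.Injective (J x₀) := (antilipschitz_of_norm_le hc).injective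
  have hk : HasFDerivAt (fun x => J x₀ (f x - f x₀)) L x₀ := by
    -- A product of `O(x - x₀)`, from differentiability of `J`, and `o(1)`, from the continuity of
    -- `f` only.
    have hr : HasFDerivAt (fun x => (J x - J x₀) (f x - f x₀)) (0 : E →L[ℝ] W) x₀ := by
      rw [hasFDerivAt_iff_isLittleO]
      have h1 : (fun x => J x - J x₀) =O[𝓝 x₀] (fun x => x - x₀) := hJ.isBigO_sub
      have h2 : (fun x => f x - f x₀) =o[𝓝 x₀] (fun _ => (1 : ℝ)) := by
        rw [isLittleO_one_iff]
        simpa using hf.tendsto.sub_const (f x₀)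
      have h3 : (fun x => (J x - J x₀) (f x - f x₀)) =O[𝓝 x₀]
          (fun x => ‖J x - J x₀‖ * ‖f x - f x₀‖) :=
        IsBigO.of_bound 1 (Eventually.of_forall fun x => by
          simpa using ContinuousLinearMap.le_opNorm (J x - J x₀) (f x - f x₀))
      simpa using h3.trans_isLittleO (h1.norm_norm.mul_isLittleO h2.norm_norm |>.trans_isBigO
        (by simpa using (isBigO_refl (fun x => x - x₀) (𝓝 x₀)).norm_left))
    have := hu.sub hr
    rw [sub_zero] at this
    refine this.congr_of_eventuallyEq ?_
    filter_upwards [h] with x hx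
    simp [← hx]
  -- `L v` is a limit of difference quotients lying in the range of `J x₀`, which is closed since `J
  -- x₀` is bounded below.
  have hmem : ∀ v, L v ∈ range (J x₀) := fun v => by
    have h1 : HasDerivAt (fun t : ℝ => J x₀ (f (x₀ + t • v) - f x₀)) (L v) 0 := by
      refine HasFDerivAt.comp_hasDerivAt (l := fun x => J x₀ (f x - f x₀)) (0 : ℝ) ?_
        (by simpa using ((hasDerivAt_id (0 : ℝ)).smul_const v).const_add x₀)
      simpa using hk
    rw [hasDerivAt_iff_tendsto_slope] at h1
    refine hcl.mem_of_tendsto h1 (Eventually.of_forall fun t => ?_)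
    refine ⟨t⁻¹ • (f (x₀ + t • v) - f x₀), ?_⟩
    simp [slope]
  let e := (J x₀).equivRange hinj hcl
  let B : E →L[ℝ] Z := (e.symm : _ →L[ℝ] Z).comp (L.codRestrict (J x₀).range fun v => hmem v)
  have hB : ∀ v, J x₀ (B v) = L v := fun v => by
    have := congrArg Subtype.val (e.apply_symm_apply ⟨L v, hmem v⟩)
    exact this
  refine ⟨B, ?_, fun v => by simp [hB, hL]⟩
  rw [hasFDerivAt_iff_isLittleO] at hk ⊢
  refine IsBigO.trans_isLittleO (IsBigO.of_bound c ?_) hk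
  refine Eventually.of_forall fun x => ?_
  have := hc (f x - f x₀ - B (x - x₀))
  rw [map_sub (J x₀), hB] at this
  simpa using this

variable [CompleteSpace E] [NormedAddCommGroup E'] [NormedSpace ℝ E'] [CompleteSpace E']

/-- A function whose pullback by a map with surjective strict derivative is differentiable is
itself differentiable. -/
theorem exists_hasFDerivAt_of_comp {P : E → E'} {P' : E →L[ℝ] E'} {x₀ : E}
    (hP : HasStrictFDerivAt P P' x₀) (hsurj : Function.Surjective P') {F : E' → Z} {B : E →L[ℝ] Z}
    (hF : HasFDerivAt (fun x => F (P x)) B x₀) :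
    ∃ T : E' →L[ℝ] Z, HasFDerivAt F T (P x₀) ∧ ∀ v, T (P' v) = B v := by
  -- `F ∘ P` is constant along a curve in the fibre tangent to `v`, so `B` kills the kernel of `P'`
  -- and factors through `P'`.
  obtain ⟨T, hT⟩ := exists_comp_eq_of_ker_le hsurj B fun v hv => by
    obtain ⟨c, hc, ho⟩ := exists_curve_in_fiber hP hsurj hv
    have hcd : HasDerivAt c v 0 := by
      have h0 : c 0 = x₀ := by
        have := ho.def (c := 1) one_pos |>.self_of_nhds
        simpa [sub_eq_zero] using this
      rw [hasDerivAt_iff_isLittleO]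
      simpa [h0] using ho
    have h0 : c 0 = x₀ := by
      have := ho.def (c := 1) one_pos |>.self_of_nhds
      simpa [sub_eq_zero] using this
    have h1 : HasDerivAt (fun t => F (P (c t))) (B v) 0 :=
      HasFDerivAt.comp_hasDerivAt (l := fun x => F (P x)) (0 : ℝ) (by rwa [h0]) hcd
    have h2 : HasDerivAt (fun t => F (P (c t))) 0 0 :=
      (hasDerivAt_const (0 : ℝ) (F (P x₀))).congr_of_eventuallyEq (hc.mono fun t ht => by simp [ht])
    exact h1.unique h2
  refine ⟨T, ?_, hT⟩
  obtain ⟨C, hC, hreg⟩ := exists_preimage_near hP hsurj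
  have hev : ∀ᶠ y in 𝓝 (P x₀), ∃ x', P x' = y ∧ ‖x' - x₀‖ ≤ C * ‖y - P x₀‖ :=
    (tendsto_const_nhds.prodMk_nhds tendsto_id : Tendsto (fun y => (x₀, y)) (𝓝 (P x₀))
      (𝓝 (x₀, P x₀))).eventually hreg
  classical
  -- A pointwise right inverse of `P` near `P x₀`, possibly discontinuous away from `P x₀`. The
  -- bound `σ y - x₀ = O(y - P x₀)` is all that the expansion of `F` at `P x₀` needs.
  let σ : E' → E := fun y => if H : ∃ x', P x' = y ∧ ‖x' - x₀‖ ≤ C * ‖y - P x₀‖ then H.choose else x₀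
  have hσ : ∀ᶠ y in 𝓝 (P x₀), P (σ y) = y ∧ ‖σ y - x₀‖ ≤ C * ‖y - P x₀‖ := by
    filter_upwards [hev] with y hy
    simp only [σ, dif_pos hy]
    exact hy.choose_spec
  have hO : (fun y => σ y - x₀) =O[𝓝 (P x₀)] (fun y => y - P x₀) :=
    IsBigO.of_bound C (hσ.mono fun y hy => hy.2)
  have htend : Tendsto σ (𝓝 (P x₀)) (𝓝 x₀) := by
    have : Tendsto (fun y => σ y - x₀) (𝓝 (P x₀)) (𝓝 0) :=
      hO.trans_tendsto (by simpa using (tendsto_id (x := 𝓝 (P x₀))).sub_const (P x₀))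
    simpa using this.add_const x₀
  have h1 : (fun y => F (P (σ y)) - F (P x₀) - B (σ y - x₀)) =o[𝓝 (P x₀)] (fun y => y - P x₀) :=
    ((hasFDerivAt_iff_isLittleO.1 hF).comp_tendsto htend).trans_isBigO hO
  have h2 : (fun y => P (σ y) - P x₀ - P' (σ y - x₀)) =o[𝓝 (P x₀)] (fun y => y - P x₀) :=
    ((hasFDerivAt_iff_isLittleO.1 hP.hasFDerivAt).comp_tendsto htend).trans_isBigO hO
  have h3 : (fun y => T (P (σ y) - P x₀ - P' (σ y - x₀))) =o[𝓝 (P x₀)] (fun y => y - P x₀) :=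
    (T.isBigO_comp _ _).trans_isLittleO h2
  rw [hasFDerivAt_iff_isLittleO]
  refine (h1.sub h3).congr' ?_ EventuallyEq.rfl
  filter_upwards [hσ] with y hy
  rw [hy.1, map_sub T, hT]
  abel

end Descent

/-! ### Descent of higher differentiability -/

section DescentSmooth

universe u v

variable {E : Type v} {E' : Type u} [NormedAddCommGroup E] [NormedSpace ℝ E] [CompleteSpace E]
  [NormedAddCommGroup E'] [NormedSpace ℝ E'] [CompleteSpace E']

/-- Differentiating `J x (F (P x)) = s x` gives `J x ∘ DF (P x) ∘ DP x = Ds x - DJ x (·) (F (P x))`.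
This is an equation of the same form for `DF`, with the operator `T ↦ J x ∘ T ∘ DP x`, again bounded
below because `DP x` is an open surjection. Hence the induction on `n` runs over all `Z`, `W` and
`J`, even if one starts from `J = id`. The universes are chosen so that `E' →L[ℝ] Z` and `E →L[ℝ] W`
stay in those of `Z` and `W`. -/
theorem contDiffOn_nat_of_clm_apply_comp_eq {U : Set E} (hU : IsOpen U) {P : E → E'}
    (hP₁ : ContDiffOn ℝ 1 P U) (hsurj : ∀ x ∈ U, Function.Surjective (fderiv ℝ P x)) (n : ℕ)
    (hP : ContDiffOn ℝ n P U) :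
    ∀ {Z : Type u} {W : Type max u v} [NormedAddCommGroup Z] [NormedSpace ℝ Z] [CompleteSpace Z]
      [NormedAddCommGroup W] [NormedSpace ℝ W] [CompleteSpace W]
      {J : E → Z →L[ℝ] W} (_ : ContDiffOn ℝ n J U) (_ : ∀ x ∈ U, ∃ c, ∀ z, ‖z‖ ≤ c * ‖J x z‖)
      {F : E' → Z} {s : E → W} (_ : ContDiffOn ℝ n s U) (_ : ∀ x ∈ U, J x (F (P x)) = s x),
      ContDiffOn ℝ n F (P '' U) := by
  have hPs : ∀ x ∈ U, HasStrictFDerivAt P (fderiv ℝ P x) x := fun x hx =>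
    (hP₁.contDiffAt (hU.mem_nhds hx)).hasStrictFDerivAt (by simp)
  have hV : IsOpen (P '' U) := by
    rw [isOpen_iff_mem_nhds]
    rintro _ ⟨x, hx, rfl⟩
    rw [← (hPs x hx).map_nhds_eq_of_surj (LinearMap.range_eq_top.2 (hsurj x hx))]
    exact image_mem_map (hU.mem_nhds hx)
  induction n with
  | zero =>
    intro Z W _ _ _ _ _ _ J hJ hJb F s hs h
    rw [Nat.cast_zero, contDiffOn_zero] at hs ⊢
    rintro _ ⟨x, hx, rfl⟩
    obtain ⟨c, hc⟩ := hJb x hx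
    have h1 : ContinuousAt (fun x => F (P x)) x :=
      continuousAt_of_clm_apply_eq (hJ.continuousOn.continuousAt (hU.mem_nhds hx))
        (hs.continuousAt (hU.mem_nhds hx)) hc (Filter.eventually_of_mem (hU.mem_nhds hx) h)
    refine ContinuousAt.continuousWithinAt ?_
    rw [ContinuousAt, ← (hPs x hx).map_nhds_eq_of_surj (LinearMap.range_eq_top.2 (hsurj x hx)),
      tendsto_map'_iff]
    exact h1
  | succ n ih =>
    intro Z W _ _ _ _ _ _ J hJ hJb F s hs h
    have hPn : ContDiffOn ℝ n P U := hP.of_le (by simp)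
    -- Needed because `F ∘ P` occurs in the right-hand side of the differentiated equation.
    have hFn : ContDiffOn ℝ n F (P '' U) := ih hPn (hJ.of_le (by simp)) hJb (hs.of_le (by simp)) h
    have hd : ∀ x ∈ U, ∃ T : E' →L[ℝ] Z, HasFDerivAt F T (P x) ∧
        ∀ v, J x (T (fderiv ℝ P x v)) = fderiv ℝ s x v - fderiv ℝ J x v (F (P x)) := by
      intro x hx
      obtain ⟨c, hc⟩ := hJb x hx
      obtain ⟨B, hB, hB'⟩ := exists_hasFDerivAt_of_clm_apply_eq
        (((hJ.contDiffAt (hU.mem_nhds hx)).differentiableAt (by simp)).hasFDerivAt)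
        (((hs.contDiffAt (hU.mem_nhds hx)).differentiableAt (by simp)).hasFDerivAt) hc
        (Filter.eventually_of_mem (hU.mem_nhds hx) h)
      obtain ⟨T, hT, hT'⟩ := exists_hasFDerivAt_of_comp (hPs x hx) (hsurj x hx) hB
      exact ⟨T, hT, fun v => by rw [hT', hB']⟩
    rw [Nat.cast_succ, contDiffOn_succ_iff_fderiv_of_isOpen hV]
    refine ⟨?_, by simp, ?_⟩
    · rintro _ ⟨x, hx, rfl⟩
      obtain ⟨T, hT, -⟩ := hd x hx
      exact hT.differentiableAt.differentiableWithinAt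
    have hDP : ContDiffOn ℝ n (fderiv ℝ P) U := hP.fderiv_of_isOpen hU (by simp)
    refine ih hPn (Z := E' →L[ℝ] Z) (W := E →L[ℝ] W)
      (J := fun x => (ContinuousLinearMap.compL ℝ E Z W (J x)).comp
        ((ContinuousLinearMap.compL ℝ E E' Z).flip (fderiv ℝ P x))) ?_ ?_
      (s := fun x => fderiv ℝ s x - (ContinuousLinearMap.apply ℝ W (F (P x))).comp (fderiv ℝ J x)) ?_ ?_
    · exact ((ContinuousLinearMap.compL ℝ E Z W).contDiff.comp_contDiffOn (hJ.of_le (by simp))).clm_comp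
        ((ContinuousLinearMap.compL ℝ E E' Z).flip.contDiff.comp_contDiffOn hDP)
    · intro x hx
      obtain ⟨c, hc⟩ := hJb x hx
      obtain ⟨C, hC, hpre⟩ := (fderiv ℝ P x).exists_preimage_norm_le (hsurj x hx)
      have hc' : ∀ z, ‖z‖ ≤ |c| * ‖J x z‖ := fun z =>
        (hc z).trans (by gcongr; exact le_abs_self c)
      refine ⟨|c| * C, fun T => ContinuousLinearMap.opNorm_le_bound _ (by positivity) fun y => ?_⟩
      obtain ⟨v, hv, hvn⟩ := hpre y
      set S := ((ContinuousLinearMap.compL ℝ E Z W (J x)).comp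
        ((ContinuousLinearMap.compL ℝ E E' Z).flip (fderiv ℝ P x))) T with hS
      have hSv : J x (T y) = S v := by simp [hS, hv]
      calc ‖T y‖ ≤ |c| * ‖J x (T y)‖ := hc' _
        _ ≤ |c| * (‖S‖ * ‖v‖) := by rw [hSv]; gcongr; exact S.le_opNorm v
        _ ≤ |c| * (‖S‖ * (C * ‖y‖)) := by gcongr
        _ = _ := by ring
    · have h1 : ContDiffOn ℝ n (fderiv ℝ s) U := hs.fderiv_of_isOpen hU (by simp)
      have h2 : ContDiffOn ℝ n (fderiv ℝ J) U := hJ.fderiv_of_isOpen hU (by simp)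
      have h3 : ContDiffOn ℝ n (fun x => F (P x)) U :=
        hFn.comp hPn (mapsTo_image P U)
      have h4 : ContDiff ℝ n (fun z : Z => ContinuousLinearMap.apply ℝ W z) := by
        fun_prop
      exact h1.sub ((h4.comp_contDiffOn h3).clm_comp h2)
    · intro x hx
      obtain ⟨T, hT, hT'⟩ := hd x hx
      ext v
      simp [hT.fderiv, hT']

/-- Smoothness descends along a smooth map `P` with surjective derivative: if `J x (F (P x))` is a
smooth function of `x`, where `J` is a smooth family of operators bounded below, then `F` is
smooth. The kernel of the derivative of `P` need not be complemented. -/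
theorem contDiffAt_of_clm_apply_comp_eq {P : E → E'} {x₀ : E} (hP : ContDiffAt ℝ ∞ P x₀)
    (hsurj : ∀ᶠ x in 𝓝 x₀, Function.Surjective (fderiv ℝ P x))
    {Z : Type u} {W : Type max u v} [NormedAddCommGroup Z] [NormedSpace ℝ Z] [CompleteSpace Z]
    [NormedAddCommGroup W] [NormedSpace ℝ W] [CompleteSpace W]
    {J : E → Z →L[ℝ] W} (hJ : ContDiffAt ℝ ∞ J x₀)
    (hJb : ∀ᶠ x in 𝓝 x₀, ∃ c, ∀ z, ‖z‖ ≤ c * ‖J x z‖)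
    {F : E' → Z} {s : E → W} (hs : ContDiffAt ℝ ∞ s x₀) (h : ∀ᶠ x in 𝓝 x₀, J x (F (P x)) = s x) :
    ContDiffAt ℝ ∞ F (P x₀) := by
  -- For each finite order, differentiability at `x₀` persists on a neighbourhood, which may depend
  -- on the order.
  rw [contDiffAt_infty]
  intro n
  have key : ∀ {X : Type max u v} [NormedAddCommGroup X] [NormedSpace ℝ X] {f : E → X},
    ContDiffAt ℝ ∞ f x₀ → ∀ᶠ x in 𝓝 x₀, ContDiffAt ℝ n f x := fun hf =>
      (hf.of_le (by exact_mod_cast le_top)).eventually (by simp)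
  have hPn := (hP.of_le (m := n) (by exact_mod_cast le_top)).eventually (by simp)
  have hP1 := (hP.of_le (m := 1) (by exact_mod_cast le_top)).eventually (by simp)
  have hV := hPn.and (hP1.and (hsurj.and ((key hJ).and (hJb.and ((key hs).and h)))))
  obtain ⟨U, hUV, hU, hx₀⟩ := mem_nhds_iff.1 hV
  have := contDiffOn_nat_of_clm_apply_comp_eq hU
    (fun x hx => (hUV hx).2.1.contDiffWithinAt) (fun x hx => (hUV hx).2.2.1) n
    (fun x hx => (hUV hx).1.contDiffWithinAt) (J := J) (F := F) (s := s)
    (fun x hx => (hUV hx).2.2.2.1.contDiffWithinAt) (fun x hx => (hUV hx).2.2.2.2.1)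
    (fun x hx => (hUV hx).2.2.2.2.2.1.contDiffWithinAt) (fun x hx => (hUV hx).2.2.2.2.2.2)
  refine this.contDiffAt ?_
  have hst : HasStrictFDerivAt P (fderiv ℝ P x₀) x₀ := hP.hasStrictFDerivAt (by simp)
  rw [← hst.map_nhds_eq_of_surj (LinearMap.range_eq_top.2 hsurj.self_of_nhds)]
  exact image_mem_map (hU.mem_nhds hx₀)

end DescentSmooth

/-! ### The Nijenhuis torsion in a Banach space -/

section FlatTorsion

variable {E E' : Type*} [NormedAddCommGroup E] [NormedSpace ℝ E]
  [NormedAddCommGroup E'] [NormedSpace ℝ E']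

/-- The Nijenhuis torsion is tensorial: it depends only on the values of the vector fields. -/
theorem torsion_eq_of_hasFDerivAt {n : E → E →L[ℝ] E} {n' : E →L[ℝ] E →L[ℝ] E} {x : E}
    (hn : HasFDerivAt n n' x) {X Y : E → E} (hX : DifferentiableAt ℝ X x)
    (hY : DifferentiableAt ℝ Y x) :
    n x (VectorField.lieBracket ℝ (fun z => n z (X z)) Y x)
      + n x (VectorField.lieBracket ℝ X (fun z => n z (Y z)) x)
      - VectorField.lieBracket ℝ (fun z => n z (X z)) (fun z => n z (Y z)) x
      - n x (n x (VectorField.lieBracket ℝ X Y x))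
    = n x (n' (X x) (Y x) - n' (Y x) (X x)) - n' (n x (X x)) (Y x) + n' (n x (Y x)) (X x) := by
  have h1 : ∀ {Z : E → E}, DifferentiableAt ℝ Z x → ∀ v,
      fderiv ℝ (fun z => n z (Z z)) x v = n x (fderiv ℝ Z x v) + n' v (Z x) := fun hZ v => by
    rw [(hn.clm_apply hZ.hasFDerivAt).fderiv]; simp
  simp only [VectorField.lieBracket, h1 hX, h1 hY, map_sub, map_add]
  abel

/-- Naturality of the Nijenhuis torsion. -/
theorem torsion_natural {P : E → E'} {x : E} (hP : ContDiffAt ℝ 2 P x)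
    {n : E → E →L[ℝ] E} {m : E' → E' →L[ℝ] E'} (hn : DifferentiableAt ℝ n x)
    (hm : DifferentiableAt ℝ m (P x))
    (h : ∀ᶠ z in 𝓝 x, ∀ v, fderiv ℝ P z (n z v) = m (P z) (fderiv ℝ P z v)) (v w : E) :
    fderiv ℝ P x (n x (fderiv ℝ n x v w - fderiv ℝ n x w v) - fderiv ℝ n x (n x v) w
      + fderiv ℝ n x (n x w) v)
    = m (P x) (fderiv ℝ m (P x) (fderiv ℝ P x v) (fderiv ℝ P x w)
        - fderiv ℝ m (P x) (fderiv ℝ P x w) (fderiv ℝ P x v))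
      - fderiv ℝ m (P x) (m (P x) (fderiv ℝ P x v)) (fderiv ℝ P x w)
      + fderiv ℝ m (P x) (m (P x) (fderiv ℝ P x w)) (fderiv ℝ P x v) := by
  have hsymm : IsSymmSndFDerivAt ℝ P x := hP.isSymmSndFDerivAt (by simp)
  have hP' : DifferentiableAt ℝ (fderiv ℝ P) x :=
    (hP.fderiv_right (m := 1) (by norm_num)).differentiableAt (by simp)
  have hP1 : DifferentiableAt ℝ P x := hP.differentiableAt (by simp)
  -- The derivative of the intertwining relation in direction `a`, applied to the constant vector
  -- `b`.
  have key : ∀ a b, fderiv ℝ P x (fderiv ℝ n x a b) =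
      fderiv ℝ m (P x) (fderiv ℝ P x a) (fderiv ℝ P x b)
        + m (P x) (fderiv ℝ (fderiv ℝ P) x a b) - fderiv ℝ (fderiv ℝ P) x a (n x b) := by
    intro a b
    have hl := hP'.hasFDerivAt.clm_apply (hn.hasFDerivAt.clm_apply (hasFDerivAt_const b x))
    have hr := (hm.hasFDerivAt.comp x hP1.hasFDerivAt).clm_apply
      (hP'.hasFDerivAt.clm_apply (hasFDerivAt_const b x))
    have := congrArg (fun T => T a) ((hl.congr_of_eventuallyEq
      (h.mono fun z hz => (hz b).symm)).unique hr)
    simp at this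
    rw [eq_sub_iff_add_eq, this, add_comm]
  have hx := h.self_of_nhds
  simp only [map_add, map_sub, hx, key]
  -- The second derivatives of `P` cancel in pairs by symmetry.
  rw [hsymm.eq w v, hsymm.eq (n x v) w, hsymm.eq (n x w) v, hsymm.eq (n x v) (n x w)]
  abel

end FlatTorsion

/-! ### Smoothness and torsion in charts -/

section Charts

variable {E M : Type*} [NormedAddCommGroup E] [NormedSpace ℝ E]
  [TopologicalSpace M] [ChartedSpace E M]

/-- The differential at `x` of the chart centred at `x₀`. -/
noncomputable def chartFwd (x₀ x : M) : TangentSpace 𝓘(ℝ, E) x →L[ℝ] E :=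
  mfderiv 𝓘(ℝ, E) 𝓘(ℝ, E) (extChartAt 𝓘(ℝ, E) x₀) x

/-- The differential at `y` of the inverse of the chart centred at `x₀`. -/
noncomputable def chartBwd (x₀ : M) (y : E) :
    E →L[ℝ] TangentSpace 𝓘(ℝ, E) ((extChartAt 𝓘(ℝ, E) x₀).symm y) :=
  mfderiv 𝓘(ℝ, E) 𝓘(ℝ, E) (extChartAt 𝓘(ℝ, E) x₀).symm y

/-- A vector field read in the chart centred at `x₀`. -/
noncomputable def chartField (X : ∀ p : M, TangentSpace 𝓘(ℝ, E) p) (x₀ : M) (y : E) : E :=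
  chartFwd x₀ _ (X ((extChartAt 𝓘(ℝ, E) x₀).symm y))

/-- A field of operators on the tangent spaces read in the chart centred at `x₀`. -/
noncomputable def chartOp (N : ∀ p : M, TangentSpace 𝓘(ℝ, E) p →L[ℝ] TangentSpace 𝓘(ℝ, E) p)
    (x₀ : M) (y : E) : E →L[ℝ] E :=
  (chartFwd x₀ _).comp ((N ((extChartAt 𝓘(ℝ, E) x₀).symm y)).comp (chartBwd x₀ y))

variable [IsManifold 𝓘(ℝ, E) ∞ M]

theorem chartBwd_chartFwd {x₀ : M} {y : E} (hy : y ∈ (extChartAt 𝓘(ℝ, E) x₀).target)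
    (v : TangentSpace 𝓘(ℝ, E) ((extChartAt 𝓘(ℝ, E) x₀).symm y)) :
    chartBwd x₀ y (chartFwd x₀ _ v) = v := by
  have := mfderivWithin_extChartAt_symm_comp_mfderiv_extChartAt hy
  rw [ModelWithCorners.range_eq_univ, mfderivWithin_univ] at this
  exact congrArg (fun T : E →L[ℝ] E => T v) this

theorem mdifferentiableAt_chart_symm {x₀ : M} {y : E} (hy : y ∈ (extChartAt 𝓘(ℝ, E) x₀).target) :
    MDifferentiableAt 𝓘(ℝ, E) 𝓘(ℝ, E) (extChartAt 𝓘(ℝ, E) x₀).symm y := by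
  have := mdifferentiableWithinAt_extChartAt_symm hy
  rwa [ModelWithCorners.range_eq_univ, mdifferentiableWithinAt_univ] at this

/-- The tangent space at `x₀` is identified with `E` through the preferred chart at `x₀`, so that
chart has the identity as its differential there. -/
theorem chartFwd_self (x₀ : M) (v : TangentSpace 𝓘(ℝ, E) x₀) : chartFwd x₀ x₀ v = v :=
  congrArg (fun T : E →L[ℝ] E => T v) (mfderiv_extChartAt_self (I := 𝓘(ℝ, E)) (x := x₀))

theorem chartBwd_self (x₀ : M) (v : E) : chartBwd x₀ (extChartAt 𝓘(ℝ, E) x₀ x₀) v = v := by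
  have := mfderivWithin_range_extChartAt_symm (I := 𝓘(ℝ, E)) (x := x₀)
  rw [ModelWithCorners.range_eq_univ, mfderivWithin_univ] at this
  exact congrArg (fun T : E →L[ℝ] E => T v) this

theorem chartField_self (X : ∀ p : M, TangentSpace 𝓘(ℝ, E) p) (x₀ : M) :
    chartField X x₀ (extChartAt 𝓘(ℝ, E) x₀ x₀) = X x₀ := by
  -- The point is generalized to a variable so that the equality of base points can be substituted
  -- inside dependent types. The same device recurs below for `g * 1 = g` and the like.
  have : ∀ z, z = x₀ → chartFwd x₀ z (X z) = X x₀ := by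
    rintro _ rfl; exact chartFwd_self _ _
  exact this _ (extChartAt_to_inv x₀)

theorem chartOp_self (N : ∀ p : M, TangentSpace 𝓘(ℝ, E) p →L[ℝ] TangentSpace 𝓘(ℝ, E) p)
    (x₀ : M) (v : TangentSpace 𝓘(ℝ, E) x₀) :
    chartOp N x₀ (extChartAt 𝓘(ℝ, E) x₀ x₀) v = N x₀ v := by
  have : ∀ z, z = x₀ → ∀ w : E, (chartFwd x₀ z (N z w) : E) = N x₀ w := by
    rintro _ rfl w; exact chartFwd_self _ _
  refine (this _ (extChartAt_to_inv x₀) _).trans ?_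
  exact congrArg (N x₀) (chartBwd_self (E := E) x₀ v)

theorem chartOp_chartField (N : ∀ p : M, TangentSpace 𝓘(ℝ, E) p →L[ℝ] TangentSpace 𝓘(ℝ, E) p)
    (X : ∀ p : M, TangentSpace 𝓘(ℝ, E) p) {x₀ : M} {y : E}
    (hy : y ∈ (extChartAt 𝓘(ℝ, E) x₀).target) :
    chartField (fun q => N q (X q)) x₀ y = chartOp N x₀ y (chartField X x₀ y) := by
  simp only [chartField, chartOp, ContinuousLinearMap.comp_apply]
  rw [chartBwd_chartFwd hy]

theorem mpullbackWithin_eq_chartField (X : ∀ p : M, TangentSpace 𝓘(ℝ, E) p) {x₀ : M} {y : E}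
    (hy : y ∈ (extChartAt 𝓘(ℝ, E) x₀).target) :
    VectorField.mpullbackWithin 𝓘(ℝ, E) 𝓘(ℝ, E) (extChartAt 𝓘(ℝ, E) x₀).symm X
      (range 𝓘(ℝ, E)) y = chartField X x₀ y := by
  rw [VectorField.mpullbackWithin_apply, ContinuousLinearMap.inverse_eq
    (mfderivWithin_extChartAt_symm_comp_mfderiv_extChartAt hy)
    (mfderiv_extChartAt_comp_mfderivWithin_extChartAt_symm hy)]
  rfl

theorem mlieBracket_eq_lieBracket_chartField (X Y : ∀ p : M, TangentSpace 𝓘(ℝ, E) p) (x₀ : M) :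
    VectorField.mlieBracket 𝓘(ℝ, E) X Y x₀ =
      VectorField.lieBracket ℝ (chartField X x₀) (chartField Y x₀) (extChartAt 𝓘(ℝ, E) x₀ x₀) := by
  have hev : ∀ Z : ∀ p : M, TangentSpace 𝓘(ℝ, E) p,
      VectorField.mpullbackWithin 𝓘(ℝ, E) 𝓘(ℝ, E) (extChartAt 𝓘(ℝ, E) x₀).symm Z (range 𝓘(ℝ, E))
        =ᶠ[𝓝 (extChartAt 𝓘(ℝ, E) x₀ x₀)] chartField Z x₀ := fun Z => by
    filter_upwards [(isOpen_extChartAt_target x₀).mem_nhds (mem_extChartAt_target x₀)] with y hy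
    exact mpullbackWithin_eq_chartField Z hy
  -- The bracket is carried back to the manifold by the inverse differential of the chart, which is
  -- the identity at the centre.
  have hinv : ∀ w : E, (mfderiv 𝓘(ℝ, E) 𝓘(ℝ, E) (extChartAt 𝓘(ℝ, E) x₀) x₀).inverse w = w := by
    have h := mfderiv_extChartAt_self (I := 𝓘(ℝ, E)) (x := x₀)
    intro w
    have h' := congrArg (fun T : E →L[ℝ] E => T.inverse w) h
    exact h'.trans (congrArg (fun T : E →L[ℝ] E => T w) ContinuousLinearMap.inverse_id)
  rw [VectorField.mlieBracket, VectorField.mlieBracketWithin_apply]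
  refine (hinv _).trans (Eq.trans ?_ ((hev X).lieBracket_vectorField_eq (hev Y)))
  rw [preimage_univ, univ_inter]
  have hr : range 𝓘(ℝ, E) = univ := ModelWithCorners.range_eq_univ _
  exact (congrArg (fun s : Set E => VectorField.lieBracketWithin ℝ
    (fun y : E => VectorField.mpullbackWithin 𝓘(ℝ, E) 𝓘(ℝ, E) (extChartAt 𝓘(ℝ, E) x₀).symm X
      (range 𝓘(ℝ, E)) y)
    (fun y : E => VectorField.mpullbackWithin 𝓘(ℝ, E) 𝓘(ℝ, E) (extChartAt 𝓘(ℝ, E) x₀).symm Y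
      (range 𝓘(ℝ, E)) y) s (extChartAt 𝓘(ℝ, E) x₀ x₀)) hr).trans
    (congrFun VectorField.lieBracketWithin_univ _)

theorem differentiableAt_chartField [CompleteSpace E] {X : ∀ p : M, TangentSpace 𝓘(ℝ, E) p}
    {x₀ : M} (hX : MDifferentiableAt 𝓘(ℝ, E) 𝓘(ℝ, E).tangent
      (fun p => (⟨p, X p⟩ : TangentBundle 𝓘(ℝ, E) M)) x₀) :
    DifferentiableAt ℝ (chartField X x₀) (extChartAt 𝓘(ℝ, E) x₀ x₀) := by
  have : IsManifold 𝓘(ℝ, E) 2 M := IsManifold.of_le (n := ∞) (by norm_cast)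
  rw [← mdifferentiableWithinAt_univ] at hX
  have h := hX.differentiableWithinAt_mpullbackWithin_vectorField
  rw [preimage_univ, univ_inter] at h
  refine (h.differentiableAt (by simp)).congr_of_eventuallyEq ?_
  filter_upwards [(isOpen_extChartAt_target x₀).mem_nhds (mem_extChartAt_target x₀)] with y hy
  exact (mpullbackWithin_eq_chartField X hy).symm

end Charts

/-! ### Maps and torsion read in charts -/

section LocalExpression

variable {E M E' M' : Type*} [NormedAddCommGroup E] [NormedSpace ℝ E]
  [TopologicalSpace M] [ChartedSpace E M]
  [NormedAddCommGroup E'] [NormedSpace ℝ E']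
  [TopologicalSpace M'] [ChartedSpace E' M']

variable (E E') in
/-- The expression of `f` in the charts centred at `x₀` and `f x₀`. -/
noncomputable def localExpr (f : M → M') (x₀ : M) (y : E) : E' :=
  extChartAt 𝓘(ℝ, E') (f x₀) (f ((extChartAt 𝓘(ℝ, E) x₀).symm y))

variable (E E') in
theorem localExpr_self (f : M → M') (x₀ : M) :
    localExpr E E' f x₀ (extChartAt 𝓘(ℝ, E) x₀ x₀) = extChartAt 𝓘(ℝ, E') (f x₀) (f x₀) := by
  simp [localExpr]

theorem contDiffAt_localExpr {f : M → M'} {x₀ : M}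
    (hf : ContMDiffAt 𝓘(ℝ, E) 𝓘(ℝ, E') ∞ f x₀) :
    ContDiffAt ℝ ∞ (localExpr E E' f x₀) (extChartAt 𝓘(ℝ, E) x₀ x₀) := by
  have := (contMDiffAt_iff.1 hf).2
  rw [ModelWithCorners.range_eq_univ, contDiffWithinAt_univ] at this
  exact this

theorem contMDiffAt_comp_chart_symm {X : Type*} [NormedAddCommGroup X] [NormedSpace ℝ X]
    {f : M → X} {x₀ : M} (hf : ContMDiffAt 𝓘(ℝ, E) 𝓘(ℝ, X) ∞ f x₀) :
    ContDiffAt ℝ ∞ (fun y => f ((extChartAt 𝓘(ℝ, E) x₀).symm y)) (extChartAt 𝓘(ℝ, E) x₀ x₀) := by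
  have := (contMDiffAt_iff.1 hf).2
  rw [ModelWithCorners.range_eq_univ, contDiffWithinAt_univ] at this
  exact this

theorem fderiv_localExpr_self {f : M → M'} {x₀ : M}
    (hf : MDifferentiableAt 𝓘(ℝ, E) 𝓘(ℝ, E') f x₀) (v : E) :
    fderiv ℝ (localExpr E E' f x₀) (extChartAt 𝓘(ℝ, E) x₀ x₀) v = mfderiv 𝓘(ℝ, E) 𝓘(ℝ, E') f x₀ v := by
  rw [hf.mfderiv, ModelWithCorners.range_eq_univ, fderivWithin_univ]
  rfl

theorem eventually_mem_source {f : M → M'} {x₀ : M} (hf : ContinuousAt f x₀) :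
    ∀ᶠ y in 𝓝 (extChartAt 𝓘(ℝ, E) x₀ x₀),
      f ((extChartAt 𝓘(ℝ, E) x₀).symm y) ∈ (extChartAt 𝓘(ℝ, E') (f x₀)).source := by
  have h1 : ContinuousAt (fun y => f ((extChartAt 𝓘(ℝ, E) x₀).symm y))
      (extChartAt 𝓘(ℝ, E) x₀ x₀) := by
    refine ContinuousAt.comp (g := f) ?_ (continuousAt_extChartAt_symm x₀)
    rwa [extChartAt_to_inv]
  refine h1.eventually_mem ?_
  rw [extChartAt_to_inv]
  exact extChartAt_source_mem_nhds _

theorem eventually_mem_target (x₀ : M) :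
    ∀ᶠ y in 𝓝 (extChartAt 𝓘(ℝ, E) x₀ x₀), y ∈ (extChartAt 𝓘(ℝ, E) x₀).target :=
  (isOpen_extChartAt_target x₀).mem_nhds (mem_extChartAt_target x₀)

variable (E E') in
theorem symm_localExpr {f : M → M'} {x₀ : M} {y : E}
    (hy : f ((extChartAt 𝓘(ℝ, E) x₀).symm y) ∈ (extChartAt 𝓘(ℝ, E') (f x₀)).source) :
    (extChartAt 𝓘(ℝ, E') (f x₀)).symm (localExpr E E' f x₀ y) = f ((extChartAt 𝓘(ℝ, E) x₀).symm y) :=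
  (extChartAt 𝓘(ℝ, E') (f x₀)).left_inv hy

theorem differentiableAt_chartOp
    {N : ∀ p : M, TangentSpace 𝓘(ℝ, E) p →L[ℝ] TangentSpace 𝓘(ℝ, E) p} {x₀ : M}
    (h : ContMDiffAt 𝓘(ℝ, E) 𝓘(ℝ, E →L[ℝ] E) ∞
      (fun p => chartOp N x₀ (extChartAt 𝓘(ℝ, E) x₀ p)) x₀) :
    DifferentiableAt ℝ (chartOp N x₀) (extChartAt 𝓘(ℝ, E) x₀ x₀) := by
  refine ((contMDiffAt_comp_chart_symm h).differentiableAt (by simp)).congr_of_eventuallyEq ?_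
  filter_upwards [eventually_mem_target (E := E) x₀] with y hy
  rw [(extChartAt 𝓘(ℝ, E) x₀).right_inv hy]

variable [IsManifold 𝓘(ℝ, E) ∞ M] [IsManifold 𝓘(ℝ, E') ∞ M']

theorem fderiv_localExpr {f : M → M'} (hf : MDifferentiable 𝓘(ℝ, E) 𝓘(ℝ, E') f) {x₀ : M} {y : E}
    (hy : y ∈ (extChartAt 𝓘(ℝ, E) x₀).target)
    (hy' : f ((extChartAt 𝓘(ℝ, E) x₀).symm y) ∈ (extChartAt 𝓘(ℝ, E') (f x₀)).source) (v : E) :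
    fderiv ℝ (localExpr E E' f x₀) y v = chartFwd (f x₀) _
      (mfderiv 𝓘(ℝ, E) 𝓘(ℝ, E') f ((extChartAt 𝓘(ℝ, E) x₀).symm y) (chartBwd x₀ y v)) := by
  rw [← mfderiv_eq_fderiv]
  have h1 := mdifferentiableAt_chart_symm hy
  have h2 : MDifferentiableAt 𝓘(ℝ, E') 𝓘(ℝ, E') (extChartAt 𝓘(ℝ, E') (f x₀))
      (f ((extChartAt 𝓘(ℝ, E) x₀).symm y)) :=
    mdifferentiableAt_extChartAt (by simpa using hy')
  have h3 := (HasMFDerivAt.comp (f := f ∘ (extChartAt 𝓘(ℝ, E) x₀).symm) y h2.hasMFDerivAt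
    ((hf _).hasMFDerivAt.comp y h1.hasMFDerivAt)).mfderiv
  exact congrArg (fun T : E →L[ℝ] E' => T v) h3

theorem chartOp_chartFwd (N : ∀ p : M, TangentSpace 𝓘(ℝ, E) p →L[ℝ] TangentSpace 𝓘(ℝ, E) p)
    {x₀ : M} {y : E} (hy : y ∈ (extChartAt 𝓘(ℝ, E) x₀).target) {q : M}
    (hq : q = (extChartAt 𝓘(ℝ, E) x₀).symm y) (w : TangentSpace 𝓘(ℝ, E) q) :
    chartOp N x₀ y (chartFwd x₀ q w) = chartFwd x₀ q (N q w) := by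
  subst hq
  simp only [chartOp, ContinuousLinearMap.comp_apply]
  rw [chartBwd_chartFwd hy]

/-- The torsion in terms of the derivative of `N` in a chart. -/
theorem nijenhuisTorsion_eq [CompleteSpace E]
    {N : ∀ p : M, TangentSpace 𝓘(ℝ, E) p →L[ℝ] TangentSpace 𝓘(ℝ, E) p} {x₀ : M}
    (hN : DifferentiableAt ℝ (chartOp N x₀) (extChartAt 𝓘(ℝ, E) x₀ x₀))
    {X Y : ∀ p : M, TangentSpace 𝓘(ℝ, E) p}
    (hX : MDifferentiableAt 𝓘(ℝ, E) 𝓘(ℝ, E).tangent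
      (fun p => (⟨p, X p⟩ : TangentBundle 𝓘(ℝ, E) M)) x₀)
    (hY : MDifferentiableAt 𝓘(ℝ, E) 𝓘(ℝ, E).tangent
      (fun p => (⟨p, Y p⟩ : TangentBundle 𝓘(ℝ, E) M)) x₀) {a b : E} (ha : X x₀ = a)
    (hb : Y x₀ = b) {n : E →L[ℝ] E} (hn : n = chartOp N x₀ (extChartAt 𝓘(ℝ, E) x₀ x₀))
    {n' : E →L[ℝ] E →L[ℝ] E}
    (hn' : n' = fderiv ℝ (chartOp N x₀) (extChartAt 𝓘(ℝ, E) x₀ x₀)) :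
    nijenhuisTorsion N X Y x₀ = n (n' a b - n' b a) - n' (n a) b + n' (n b) a := by
  have hNv : ∀ v : E, (N x₀ v : E) = chartOp N x₀ (extChartAt 𝓘(ℝ, E) x₀ x₀) v :=
    fun v => (chartOp_self N x₀ v).symm
  have hfield : ∀ Z : ∀ p : M, TangentSpace 𝓘(ℝ, E) p,
      chartField (fun q => N q (Z q)) x₀ =ᶠ[𝓝 (extChartAt 𝓘(ℝ, E) x₀ x₀)]
        fun y => chartOp N x₀ y (chartField Z x₀ y) := fun Z => by
    filter_upwards [eventually_mem_target x₀] with y hy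
    exact chartOp_chartField N Z hy
  have h1 : ∀ Z W, (N x₀ (VectorField.mlieBracket 𝓘(ℝ, E) Z W x₀) : E) =
      chartOp N x₀ (extChartAt 𝓘(ℝ, E) x₀ x₀)
        (VectorField.lieBracket ℝ (chartField Z x₀) (chartField W x₀) (extChartAt 𝓘(ℝ, E) x₀ x₀)) :=
    fun Z W => by
      rw [← mlieBracket_eq_lieBracket_chartField]; exact hNv _
  have key := torsion_eq_of_hasFDerivAt hN.hasFDerivAt (differentiableAt_chartField hX)
    (differentiableAt_chartField hY)
  rw [← hn, ← hn', chartField_self, chartField_self, ha, hb] at key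
  rw [← key]
  have e1 : (N x₀ (VectorField.mlieBracket 𝓘(ℝ, E) (fun q => N q (X q)) Y x₀) : E) =
      n (VectorField.lieBracket ℝ (fun y => chartOp N x₀ y (chartField X x₀ y)) (chartField Y x₀)
        (extChartAt 𝓘(ℝ, E) x₀ x₀)) := by
    rw [h1, (hfield X).lieBracket_vectorField_eq EventuallyEq.rfl, hn]
  have e2 : (N x₀ (VectorField.mlieBracket 𝓘(ℝ, E) X (fun q => N q (Y q)) x₀) : E) =
      n (VectorField.lieBracket ℝ (chartField X x₀) (fun y => chartOp N x₀ y (chartField Y x₀ y))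
        (extChartAt 𝓘(ℝ, E) x₀ x₀)) := by
    rw [h1, EventuallyEq.rfl.lieBracket_vectorField_eq (hfield Y), hn]
  have e3 : (VectorField.mlieBracket 𝓘(ℝ, E) (fun q => N q (X q)) (fun q => N q (Y q)) x₀ : E) =
      VectorField.lieBracket ℝ (fun y => chartOp N x₀ y (chartField X x₀ y))
        (fun y => chartOp N x₀ y (chartField Y x₀ y)) (extChartAt 𝓘(ℝ, E) x₀ x₀) := by
    rw [← (hfield X).lieBracket_vectorField_eq (hfield Y)]
    exact mlieBracket_eq_lieBracket_chartField _ _ _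
  have e4 : (N x₀ (N x₀ (VectorField.mlieBracket 𝓘(ℝ, E) X Y x₀)) : E) =
      n (n (VectorField.lieBracket ℝ (chartField X x₀) (chartField Y x₀)
        (extChartAt 𝓘(ℝ, E) x₀ x₀))) := by
    refine (hNv _).trans ?_
    rw [hn, ← h1]
  exact congrArg₂ (fun s t : E => s - t) (congrArg₂ (fun s t : E => s - t)
    (congrArg₂ (fun s t : E => s + t) e1 e2) e3) e4

/-- Naturality of the Nijenhuis torsion: if `f` intertwines `N` and `N'`, then it maps the torsion
of `N` to that of `N'`. -/
theorem nijenhuisTorsion_natural [CompleteSpace E] [CompleteSpace E'] {f : M → M'}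
    (hf : ContMDiff 𝓘(ℝ, E) 𝓘(ℝ, E') ∞ f) {x₀ : M}
    {N : ∀ p : M, TangentSpace 𝓘(ℝ, E) p →L[ℝ] TangentSpace 𝓘(ℝ, E) p}
    {N' : ∀ p : M', TangentSpace 𝓘(ℝ, E') p →L[ℝ] TangentSpace 𝓘(ℝ, E') p}
    (hN : DifferentiableAt ℝ (chartOp N x₀) (extChartAt 𝓘(ℝ, E) x₀ x₀))
    (hN' : DifferentiableAt ℝ (chartOp N' (f x₀)) (extChartAt 𝓘(ℝ, E') (f x₀) (f x₀)))
    (hNN' : ∀ x v, mfderiv 𝓘(ℝ, E) 𝓘(ℝ, E') f x (N x v) = N' (f x) (mfderiv 𝓘(ℝ, E) 𝓘(ℝ, E') f x v))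
    {X Y : ∀ p : M, TangentSpace 𝓘(ℝ, E) p} {X' Y' : ∀ p : M', TangentSpace 𝓘(ℝ, E') p}
    (hX : MDifferentiableAt 𝓘(ℝ, E) 𝓘(ℝ, E).tangent
      (fun p => (⟨p, X p⟩ : TangentBundle 𝓘(ℝ, E) M)) x₀)
    (hY : MDifferentiableAt 𝓘(ℝ, E) 𝓘(ℝ, E).tangent
      (fun p => (⟨p, Y p⟩ : TangentBundle 𝓘(ℝ, E) M)) x₀)
    (hX' : MDifferentiableAt 𝓘(ℝ, E') 𝓘(ℝ, E').tangent
      (fun p => (⟨p, X' p⟩ : TangentBundle 𝓘(ℝ, E') M')) (f x₀))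
    (hY' : MDifferentiableAt 𝓘(ℝ, E') 𝓘(ℝ, E').tangent
      (fun p => (⟨p, Y' p⟩ : TangentBundle 𝓘(ℝ, E') M')) (f x₀))
    (hXX' : X' (f x₀) = mfderiv 𝓘(ℝ, E) 𝓘(ℝ, E') f x₀ (X x₀))
    (hYY' : Y' (f x₀) = mfderiv 𝓘(ℝ, E) 𝓘(ℝ, E') f x₀ (Y x₀)) :
    nijenhuisTorsion N' X' Y' (f x₀) = mfderiv 𝓘(ℝ, E) 𝓘(ℝ, E') f x₀ (nijenhuisTorsion N X Y x₀) := by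
  have hfd : MDifferentiable 𝓘(ℝ, E) 𝓘(ℝ, E') f := hf.mdifferentiable (by simp)
  have hD := fun v => fderiv_localExpr_self (hfd x₀) v
  have hP := (contDiffAt_localExpr (hf x₀)).of_le (m := 2) (by norm_cast)
  have hself := localExpr_self E E' f x₀
  -- The intertwining relation holds on a whole neighbourhood in charts, so that it can be
  -- differentiated in `torsion_natural`.
  have hrel : ∀ᶠ y in 𝓝 (extChartAt 𝓘(ℝ, E) x₀ x₀), ∀ v,
      fderiv ℝ (localExpr E E' f x₀) y (chartOp N x₀ y v) =
        chartOp N' (f x₀) (localExpr E E' f x₀ y) (fderiv ℝ (localExpr E E' f x₀) y v) := by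
    filter_upwards [eventually_mem_target x₀,
      eventually_mem_source (E := E) (E' := E') hf.continuous.continuousAt] with y hy hy' v
    have ht : localExpr E E' f x₀ y ∈ (extChartAt 𝓘(ℝ, E') (f x₀)).target :=
      (extChartAt 𝓘(ℝ, E') (f x₀)).map_source hy'
    rw [fderiv_localExpr hfd hy hy', fderiv_localExpr hfd hy hy']
    simp only [chartOp, ContinuousLinearMap.comp_apply]
    rw [chartBwd_chartFwd hy, hNN']
    exact (chartOp_chartFwd N' ht (symm_localExpr E E' hy').symm _).symm
  have hnat := torsion_natural hP hN (by rwa [hself]) hrel (X x₀ : E) (Y x₀ : E)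
  have hl := nijenhuisTorsion_eq hN' hX' hY' (hXX'.trans (hD _).symm) (hYY'.trans (hD _).symm)
    rfl rfl
  have hr := nijenhuisTorsion_eq hN hX hY rfl rfl rfl rfl
  rw [hself] at hnat
  refine hl.trans (hnat.symm.trans ((hD _).trans ?_))
  exact congrArg (mfderiv 𝓘(ℝ, E) 𝓘(ℝ, E') f x₀) hr.symm

end LocalExpression

/-! ### Descent of smoothness along submersions of manifolds -/

section ManifoldDescent

universe u v

variable {E : Type v} {M : Type*} {E' : Type u} {M' : Type*}
  [NormedAddCommGroup E] [NormedSpace ℝ E]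
  [TopologicalSpace M] [ChartedSpace E M] [IsManifold 𝓘(ℝ, E) ∞ M]
  [NormedAddCommGroup E'] [NormedSpace ℝ E']
  [TopologicalSpace M'] [ChartedSpace E' M'] [IsManifold 𝓘(ℝ, E') ∞ M']

theorem IsSubmersion.eventually_surjective_fderiv {f : M → M'} (hf : IsSubmersion E E' f)
    (x₀ : M) : ∀ᶠ y in 𝓝 (extChartAt 𝓘(ℝ, E) x₀ x₀),
      Function.Surjective (fderiv ℝ (localExpr E E' f x₀) y) := by
  filter_upwards [eventually_mem_target (E := E) x₀,
    eventually_mem_source (E := E) (E' := E') (x₀ := x₀) hf.smooth.continuous.continuousAt]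
    with y hy hy' w
  obtain ⟨v, hv⟩ := hf.surjective ((extChartAt 𝓘(ℝ, E) x₀).symm y)
    (mfderiv 𝓘(ℝ, E') 𝓘(ℝ, E') (extChartAt 𝓘(ℝ, E') (f x₀)) _ |>.inverse w)
  refine ⟨chartFwd x₀ _ v, ?_⟩
  rw [fderiv_localExpr (hf.smooth.mdifferentiable (by simp)) hy hy', chartBwd_chartFwd hy, hv]
  exact (isInvertible_mfderiv_extChartAt hy').self_apply_inverse w

/-- In the bundle coordinates centred at `x₀` the operator is `chartOp N x₀`. Smoothness as an
operator-valued map is the form that descent delivers. -/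
theorem isSmoothBundleMap_of_contMDiffAt_chartOp
    {N : ∀ p : M, TangentSpace 𝓘(ℝ, E) p →L[ℝ] TangentSpace 𝓘(ℝ, E) p}
    (h : ∀ x₀, ContMDiffAt 𝓘(ℝ, E) 𝓘(ℝ, E →L[ℝ] E) ∞
      (fun p => chartOp N x₀ (extChartAt 𝓘(ℝ, E) x₀ p)) x₀) : IsSmoothBundleMap N := by
  intro ξ
  have hproj : ContMDiffAt 𝓘(ℝ, E).tangent 𝓘(ℝ, E) ∞
      (Bundle.TotalSpace.proj : TangentBundle 𝓘(ℝ, E) M → M) ξ :=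
    Bundle.contMDiff_proj (TangentSpace 𝓘(ℝ, E) : M → Type _) ξ
  refine ContMDiffAt.clm_apply_of_inCoordinates (F₁ := E) (F₂ := E)
    (b₁ := fun η : TangentBundle 𝓘(ℝ, E) M => η.1) (b₂ := fun η : TangentBundle 𝓘(ℝ, E) M => η.1)
    (ϕ := fun η : TangentBundle 𝓘(ℝ, E) M => N η.1) (v := fun η : TangentBundle 𝓘(ℝ, E) M => η.2)
    ?_ contMDiffAt_id hproj
  refine ((h ξ.1).comp ξ hproj).congr_of_eventuallyEq ?_
  filter_upwards [hproj.continuousAt.eventually_mem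
    (extChartAt_source_mem_nhds (I := 𝓘(ℝ, E)) ξ.1)] with η hη
  have hη' : η.1 ∈ (chartAt E ξ.1).source := by simpa using hη
  have := inTangentCoordinates_eq_mfderiv_comp (I := 𝓘(ℝ, E)) (I' := 𝓘(ℝ, E))
    (f := fun η : TangentBundle 𝓘(ℝ, E) M => η.1) (g := fun η : TangentBundle 𝓘(ℝ, E) M => η.1)
    (ϕ := fun η => N η.1) (x₀ := ξ) (x := η) hη' hη'
  rw [ModelWithCorners.range_eq_univ, mfderivWithin_univ] at this
  have key : ∀ (y : E) (q : M), q = (extChartAt 𝓘(ℝ, E) ξ.1).symm y → ∀ T : E →L[ℝ] E,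
      T = (mfderiv 𝓘(ℝ, E) 𝓘(ℝ, E) (extChartAt 𝓘(ℝ, E) ξ.1) q).comp ((N q).comp
        (mfderiv 𝓘(ℝ, E) 𝓘(ℝ, E) (extChartAt 𝓘(ℝ, E) ξ.1).symm y : E →L[ℝ] E)) →
      T = chartOp N ξ.1 y := by
    rintro y _ rfl T rfl
    rfl
  exact key _ _ ((extChartAt 𝓘(ℝ, E) ξ.1).left_inv hη).symm _ this

variable [CompleteSpace E] [CompleteSpace E']

/-- Smoothness descends along submersions of Banach manifolds. -/
theorem IsSubmersion.contMDiffAt_of_clm_apply_comp_eq {f : M → M'} (hf : IsSubmersion E E' f)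
    {x₀ : M} {Z : Type u} {W : Type max u v} [NormedAddCommGroup Z] [NormedSpace ℝ Z]
    [CompleteSpace Z] [NormedAddCommGroup W] [NormedSpace ℝ W] [CompleteSpace W]
    {J : M → Z →L[ℝ] W} (hJ : ContMDiffAt 𝓘(ℝ, E) 𝓘(ℝ, Z →L[ℝ] W) ∞ J x₀)
    (hJb : ∀ᶠ x in 𝓝 x₀, ∃ c, ∀ z, ‖z‖ ≤ c * ‖J x z‖) {F : M' → Z} {s : M → W}
    (hs : ContMDiffAt 𝓘(ℝ, E) 𝓘(ℝ, W) ∞ s x₀) (h : ∀ᶠ x in 𝓝 x₀, J x (F (f x)) = s x) :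
    ContMDiffAt 𝓘(ℝ, E') 𝓘(ℝ, Z) ∞ F (f x₀) := by
  have htend : Tendsto (extChartAt 𝓘(ℝ, E) x₀).symm (𝓝 (extChartAt 𝓘(ℝ, E) x₀ x₀)) (𝓝 x₀) := by
    simpa [ContinuousAt] using continuousAt_extChartAt_symm (I := 𝓘(ℝ, E)) x₀
  have key : ContDiffAt ℝ ∞ (fun y => F ((extChartAt 𝓘(ℝ, E') (f x₀)).symm y))
      (localExpr E E' f x₀ (extChartAt 𝓘(ℝ, E) x₀ x₀)) := by
    refine contDiffAt_of_clm_apply_comp_eq (contDiffAt_localExpr (hf.smooth x₀))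
      (hf.eventually_surjective_fderiv x₀) (contMDiffAt_comp_chart_symm hJ)
      (htend.eventually hJb) (contMDiffAt_comp_chart_symm hs) ?_
    filter_upwards [htend.eventually h, eventually_mem_source (E := E) (E' := E') (x₀ := x₀)
      hf.smooth.continuous.continuousAt] with y hy hy'
    rw [symm_localExpr E E' hy', hy]
  rw [localExpr_self] at key
  refine (key.contMDiffAt.comp (f x₀) contMDiffAt_extChartAt).congr_of_eventuallyEq ?_
  filter_upwards [extChartAt_source_mem_nhds (I := 𝓘(ℝ, E')) (f x₀)] with p hp
  simp only [Function.comp_apply]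
  rw [(extChartAt 𝓘(ℝ, E') (f x₀)).left_inv hp]

theorem IsSubmersion.contMDiffAt_of_comp {f : M → M'} (hf : IsSubmersion E E' f)
    {x₀ : M} {Z : Type u} [NormedAddCommGroup Z] [NormedSpace ℝ Z] [CompleteSpace Z]
    {F : M' → Z} (h : ContMDiffAt 𝓘(ℝ, E) 𝓘(ℝ, Z) ∞ (fun x => F (f x)) x₀) :
    ContMDiffAt 𝓘(ℝ, E') 𝓘(ℝ, Z) ∞ F (f x₀) := by
  -- The identity of `Z`, lifted to the universe required of `W`.
  let e : Z →L[ℝ] ULift.{v} Z := (ContinuousLinearEquiv.ulift (R₁ := ℝ) (M₁ := Z)).symm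
  refine hf.contMDiffAt_of_clm_apply_comp_eq (J := fun _ => e) (s := fun x => e (F (f x)))
    contMDiffAt_const (Eventually.of_forall fun _ => ⟨1, fun z => ?_⟩)
    (e.contMDiff.contMDiffAt.comp x₀ h) (Eventually.of_forall fun _ => rfl)
  rw [one_mul]
  exact le_of_eq (ULift.norm_up.{u, v} z).symm

/-- A field `N` of operators with `N (f x) (Q x v) = Q x (A v)`, where `Q` is a smooth family of
surjections over a submersion `f`, is smooth in charts. -/
theorem IsSubmersion.contMDiffAt_chartOp {f : M → M'} (hf : IsSubmersion E E' f)
    {N : ∀ p : M', TangentSpace 𝓘(ℝ, E') p →L[ℝ] TangentSpace 𝓘(ℝ, E') p}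
    {Q : ∀ x, E →L[ℝ] TangentSpace 𝓘(ℝ, E') (f x)} {A : E →L[ℝ] E}
    (hQ : ∀ x, Function.Surjective (Q x)) (hNQ : ∀ x v, N (f x) (Q x v) = Q x (A v)) {x₀ : M}
    (hQs : ContMDiffAt 𝓘(ℝ, E) 𝓘(ℝ, E →L[ℝ] E') ∞
      (fun x => (chartFwd (f x₀) (f x)).comp (Q x)) x₀) :
    ContMDiffAt 𝓘(ℝ, E') 𝓘(ℝ, E' →L[ℝ] E') ∞
      (fun p => chartOp N (f x₀) (extChartAt 𝓘(ℝ, E') (f x₀) p)) (f x₀) := by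
  have hsrc : ∀ᶠ x in 𝓝 x₀, f x ∈ (extChartAt 𝓘(ℝ, E') (f x₀)).source :=
    hf.smooth.continuous.continuousAt.eventually_mem (extChartAt_source_mem_nhds _)
  have hJ1 : ContDiff ℝ ∞ (fun q : E →L[ℝ] E' => (ContinuousLinearMap.compL ℝ E E' E').flip q) :=
    by fun_prop
  have hs1 : ContDiff ℝ ∞ (fun q : E →L[ℝ] E' => q.comp A) := by fun_prop
  -- With `q x` the family `Q x` read in the chart, the relation `N Q = Q A` becomes `J x (chartOp
  -- N) = q x ∘ A`, where `J x` is precomposition with `q x`; it is bounded below because `q x` is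
  -- onto.
  refine hf.contMDiffAt_of_clm_apply_comp_eq (W := E →L[ℝ] E')
    (J := fun x => (ContinuousLinearMap.compL ℝ E E' E').flip ((chartFwd (f x₀) (f x)).comp (Q x)))
    (s := fun x => ((chartFwd (f x₀) (f x)).comp (Q x)).comp A)
    (hJ1.contMDiff.contMDiffAt.comp x₀ hQs) ?_ (hs1.contMDiff.contMDiffAt.comp x₀ hQs) ?_
  · filter_upwards [hsrc] with x hx
    have hsurj : Function.Surjective ((chartFwd (f x₀) (f x)).comp (Q x)) := by
      intro w
      obtain ⟨v, hv⟩ := hQ x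
        (mfderiv 𝓘(ℝ, E') 𝓘(ℝ, E') (extChartAt 𝓘(ℝ, E') (f x₀)) (f x) |>.inverse w)
      refine ⟨v, ?_⟩
      rw [ContinuousLinearMap.comp_apply, hv]
      exact (isInvertible_mfderiv_extChartAt hx).self_apply_inverse w
    obtain ⟨C, hC, hpre⟩ := ((chartFwd (f x₀) (f x)).comp (Q x)).exists_preimage_norm_le hsurj
    refine ⟨C, fun T => ContinuousLinearMap.opNorm_le_bound _ (by positivity) fun y => ?_⟩
    obtain ⟨v, hv, hvn⟩ := hpre y
    set S := (ContinuousLinearMap.compL ℝ E E' E').flip ((chartFwd (f x₀) (f x)).comp (Q x)) T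
    have hS : T y = S v := by rw [← hv]; rfl
    calc ‖T y‖ ≤ ‖S‖ * ‖v‖ := by rw [hS]; exact S.le_opNorm v
      _ ≤ ‖S‖ * (C * ‖y‖) := by gcongr
      _ = _ := by ring
  · filter_upwards [hsrc] with x hx
    ext v
    refine (chartOp_chartFwd N ((extChartAt 𝓘(ℝ, E') (f x₀)).map_source hx)
      ((extChartAt 𝓘(ℝ, E') (f x₀)).left_inv hx).symm (Q x v)).trans ?_
    rw [hNQ]
    rfl

end ManifoldDescent

/-! ### The kernel of the differential of the quotient map -/

section Kernel

variable {E : Type*} {F : Type*} {E' : Type*} {G : Type*}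
  [NormedAddCommGroup E] [NormedSpace ℝ E] [CompleteSpace E]
  [NormedAddCommGroup F] [NormedSpace ℝ F] [CompleteSpace F]
  [NormedAddCommGroup E'] [NormedSpace ℝ E'] [CompleteSpace E']
  [Group G] [TopologicalSpace G] [ChartedSpace E G] [LieGroup 𝓘(ℝ, E) ∞ G]
  {K : Subgroup G} [ChartedSpace F K] [ChartedSpace E' (G ⧸ K)] [IsManifold 𝓘(ℝ, E') ∞ (G ⧸ K)]

/-- The Lie algebra of `K` is the kernel of the differential of the quotient map. -/
theorem mem_lieSubalgebra_iff (hK : IsImmersion F E (Subtype.val : K → G))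
    (hπ : IsSubmersion E E' (fun g : G => (g : G ⧸ K))) (v : GroupLieAlgebra 𝓘(ℝ, E) G) :
    v ∈ lieSubalgebra F K ↔ projDeriv (E' := E') K v = 0 := by
  constructor
  -- `π` is constant on `K`.
  · rintro ⟨u, rfl⟩
    have h1 : HasMFDerivAt 𝓘(ℝ, F) 𝓘(ℝ, E') (fun k : K => ((k : G) : G ⧸ K)) 1
        ((projDeriv (E' := E') K).comp (mfderiv 𝓘(ℝ, F) 𝓘(ℝ, E) (Subtype.val : K → G) 1)) :=
      HasMFDerivAt.comp (g := fun g : G => (g : G ⧸ K)) (f := (Subtype.val : K → G)) 1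
        ((hπ.smooth.mdifferentiable (by simp)) 1).hasMFDerivAt
        ((hK.smooth.mdifferentiable (by simp)) 1).hasMFDerivAt
    have h2 : (fun k : K => ((k : G) : G ⧸ K)) = fun _ => ((1 : G) : G ⧸ K) := by
      funext k
      exact QuotientGroup.eq.2 (by simp)
    have h3 : HasMFDerivAt 𝓘(ℝ, F) 𝓘(ℝ, E') (fun k : K => ((k : G) : G ⧸ K)) 1
        (0 : TangentSpace 𝓘(ℝ, F) (1 : K) →L[ℝ] TangentSpace 𝓘(ℝ, E') ((1 : G) : G ⧸ K)) := by
      rw [h2]; exact hasMFDerivAt_const _ _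
    exact congrArg (fun T : F →L[ℝ] E' => T u) (hasMFDerivAt_unique h1 h3)
  · intro hv
    obtain ⟨e, rfl⟩ : ∃ e : E, e = v := ⟨v, rfl⟩
    set q : G → G ⧸ K := fun g => (g : G ⧸ K) with hq
    set x₀ := extChartAt 𝓘(ℝ, E) (1 : G) 1 with hx₀
    have hstr : HasStrictFDerivAt (localExpr E E' q 1) (fderiv ℝ (localExpr E E' q 1) x₀) x₀ :=
      (contDiffAt_localExpr (hπ.smooth 1)).hasStrictFDerivAt (by simp)
    -- A curve tangent to `e` in the fibre of `π` through `1`, that is, in `K`.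
    obtain ⟨c, hc, ho⟩ := exists_curve_in_fiber hstr
      (hπ.eventually_surjective_fderiv 1).self_of_nhds (h := e)
      ((fderiv_localExpr_self ((hπ.smooth.mdifferentiable (by simp)) 1) e).trans hv)
    have hcO : (fun t => c t - x₀) =O[𝓝 0] (fun t : ℝ => t) := by
      have : (fun t : ℝ => t • e) =O[𝓝 0] (fun t : ℝ => t) :=
        IsBigO.of_bound ‖e‖ (Eventually.of_forall fun t => by rw [norm_smul, mul_comm])
      simpa using ho.isBigO.add this
    have hct : Tendsto c (𝓝 0) (𝓝 x₀) := by
      have : Tendsto (fun t => c t - x₀) (𝓝 0) (𝓝 0) := hcO.trans_tendsto tendsto_id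
      simpa using this.add_const x₀
    have hgt : Tendsto (fun t => (extChartAt 𝓘(ℝ, E) (1 : G)).symm (c t)) (𝓝 0) (𝓝 1) := by
      have h := continuousAt_extChartAt_symm (I := 𝓘(ℝ, E)) (1 : G)
      rw [ContinuousAt, extChartAt_to_inv] at h
      exact h.comp hct
    have hmem : ∀ᶠ t in 𝓝 (0 : ℝ), (extChartAt 𝓘(ℝ, E) (1 : G)).symm (c t) ∈ K := by
      filter_upwards [hc, hct.eventually (eventually_mem_source (E := E) (E' := E') (f := q)
        (x₀ := 1) hπ.smooth.continuous.continuousAt)] with t ht ht'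
      have := symm_localExpr E E' ht'
      rw [ht, localExpr_self, extChartAt_to_inv] at this
      simpa using QuotientGroup.eq.1 this
    classical
    -- The same curve as a map into `K`. Its continuity at `0` comes from the subspace topology;
    -- differentiability in `K` is not known.
    let k : ℝ → K := fun t => if h : (extChartAt 𝓘(ℝ, E) (1 : G)).symm (c t) ∈ K then ⟨_, h⟩ else 1
    have hk : ∀ᶠ t in 𝓝 (0 : ℝ), (k t : G) = (extChartAt 𝓘(ℝ, E) (1 : G)).symm (c t) := by
      filter_upwards [hmem] with t ht
      simp only [k, dif_pos ht]
    have hkt : Tendsto k (𝓝 0) (𝓝 1) := by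
      rw [tendsto_subtype_rng]
      exact hgt.congr' (hk.mono fun t ht => ht.symm)
    set u₀ := extChartAt 𝓘(ℝ, F) (1 : K) 1 with hu₀
    have hut : Tendsto (fun t => extChartAt 𝓘(ℝ, F) (1 : K) (k t)) (𝓝 0) (𝓝 u₀) :=
      (continuousAt_extChartAt (I := 𝓘(ℝ, F)) (1 : K)).tendsto.comp hkt
    set D : F →L[ℝ] E := mfderiv 𝓘(ℝ, F) 𝓘(ℝ, E) (Subtype.val : K → G) 1 with hD
    have hψ : HasFDerivAt (localExpr F E (Subtype.val : K → G) 1) D u₀ := by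
      have h1 := ((contDiffAt_localExpr (hK.smooth 1)).differentiableAt (by simp)).hasFDerivAt
      have h2 : fderiv ℝ (localExpr F E (Subtype.val : K → G) 1) u₀ = D :=
        ContinuousLinearMap.ext fun w =>
          fderiv_localExpr_self ((hK.smooth.mdifferentiable (by simp)) 1) w
      rwa [← hu₀, h2] at h1
    have hψu : ∀ᶠ t in 𝓝 (0 : ℝ),
        localExpr F E (Subtype.val : K → G) 1 (extChartAt 𝓘(ℝ, F) (1 : K) (k t)) = c t := by
      filter_upwards [hk, hct.eventually (eventually_mem_target (E := E) (1 : G)),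
        hkt.eventually_mem (extChartAt_source_mem_nhds (I := 𝓘(ℝ, F)) (1 : K))] with t ht ht' ht''
      rw [localExpr, (extChartAt 𝓘(ℝ, F) (1 : K)).left_inv ht'', ht]
      exact (extChartAt 𝓘(ℝ, E) (1 : G)).right_inv ht'
    have hψ0 : localExpr F E (Subtype.val : K → G) 1 u₀ = x₀ := localExpr_self F E _ _
    have hcl : IsClosed (range D) := hK.isClosed_range 1
    obtain ⟨C, hC⟩ := D.antilipschitz_of_injective_of_isClosed_range (hK.injective 1) hcl
    -- `D` is bounded below, so the coordinates of `k t` in `K` are controlled by those of `c t` in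
    -- `G`.
    have h1 : (fun t => extChartAt 𝓘(ℝ, F) (1 : K) (k t) - u₀) =O[𝓝 0] (fun t : ℝ => t) := by
      have h := (hψ.isTheta_sub
        (hC.isUniformInducing D.uniformContinuous).isInducing).2.comp_tendsto hut
      refine (h.congr' EventuallyEq.rfl ?_).trans hcO
      filter_upwards [hψu] with t ht
      simp only [Function.comp_apply, ht, hψ0]
    have h2 : (fun t => c t - x₀ - D (extChartAt 𝓘(ℝ, F) (1 : K) (k t) - u₀)) =o[𝓝 0]
        (fun t : ℝ => t) := by
      refine (((hasFDerivAt_iff_isLittleO.1 hψ).comp_tendsto hut).congr' ?_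
        EventuallyEq.rfl).trans_isBigO h1
      filter_upwards [hψu] with t ht
      simp only [Function.comp_apply, ht, hψ0]
    have h3 : (fun t => D (extChartAt 𝓘(ℝ, F) (1 : K) (k t) - u₀) - t • e) =o[𝓝 0]
        (fun t : ℝ => t) := by
      refine (ho.sub h2).congr_left fun t => ?_
      abel
    -- `e` is a limit of vectors in the range of `D`, which is closed.
    have h4 : Tendsto (fun t : ℝ => t⁻¹ • D (extChartAt 𝓘(ℝ, F) (1 : K) (k t) - u₀)) (𝓝[≠] 0)
        (𝓝 e) := by
      have h5 := (h3.mono nhdsWithin_le_nhds).tendsto_inv_smul_nhds_zero (l := 𝓝[≠] (0 : ℝ))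
      have h6 := h5.add_const e
      rw [zero_add] at h6
      refine h6.congr' ?_
      filter_upwards [self_mem_nhdsWithin] with t ht
      rw [smul_sub, smul_smul, inv_mul_cancel₀ ht, one_smul, sub_add_cancel]
    obtain ⟨w, hw⟩ := hcl.mem_of_tendsto h4 (Eventually.of_forall fun t =>
      ⟨t⁻¹ • (extChartAt 𝓘(ℝ, F) (1 : K) (k t) - u₀), map_smul D _ _⟩)
    exact ⟨w, hw⟩

end Kernel

/-! ### Smooth families of differentials -/

section Families

variable {E M E' M' E'' N : Type*} [NormedAddCommGroup E] [NormedSpace ℝ E]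
  [TopologicalSpace M] [ChartedSpace E M] [IsManifold 𝓘(ℝ, E) ∞ M]
  [NormedAddCommGroup E'] [NormedSpace ℝ E']
  [TopologicalSpace M'] [ChartedSpace E' M'] [IsManifold 𝓘(ℝ, E') ∞ M']
  [NormedAddCommGroup E''] [NormedSpace ℝ E''] [TopologicalSpace N] [ChartedSpace E'' N]
  [IsManifold 𝓘(ℝ, E'') ∞ N]

/-- The differential at `a` of a map depending smoothly on a parameter `x`, read in a chart of the
target, depends smoothly on `x`. -/
theorem contMDiffAt_chartFwd_mfderiv {f : N → M → M'} {a : M} {x₀ : N}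
    (hf : ContMDiffAt (𝓘(ℝ, E'').prod 𝓘(ℝ, E)) 𝓘(ℝ, E') ∞ (Function.uncurry f) (x₀, a)) :
    ContMDiffAt 𝓘(ℝ, E'') 𝓘(ℝ, E →L[ℝ] E') ∞
      (fun x => ((chartFwd (f x₀ a) (f x a)).comp (mfderiv 𝓘(ℝ, E) 𝓘(ℝ, E') (f x) a) : E →L[ℝ] E'))
      x₀ := by
  have h := ContMDiffAt.mfderiv (m := ∞) f (fun _ : N => a) hf contMDiffAt_const (by simp)
  refine h.congr_of_eventuallyEq ?_
  have hc : ContinuousAt (fun x => f x a) x₀ :=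
    ContinuousAt.comp (g := Function.uncurry f) (f := fun x => (x, a)) hf.continuousAt
      (by fun_prop)
  filter_upwards [hc.eventually_mem (extChartAt_source_mem_nhds (I := 𝓘(ℝ, E')) (f x₀ a))]
    with x hx
  have key := inTangentCoordinates_eq_mfderiv_comp (I := 𝓘(ℝ, E)) (I' := 𝓘(ℝ, E'))
    (f := fun _ : N => a) (g := fun x => f x a)
    (ϕ := fun x => mfderiv 𝓘(ℝ, E) 𝓘(ℝ, E') (f x) a) (x₀ := x₀) (x := x)
    (by simp) (by simpa using hx)
  rw [ModelWithCorners.range_eq_univ, mfderivWithin_univ] at key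
  refine Eq.trans ?_ key.symm
  refine ContinuousLinearMap.ext fun v : E => ?_
  have hb := chartBwd_self a v
  exact (congrArg (fun w : E => (chartFwd (f x₀ a) (f x a)
    (mfderiv 𝓘(ℝ, E) 𝓘(ℝ, E') (f x) a w) : E')) hb).symm

theorem isSmoothField_of_contMDiffAt_chartFwd {X : ∀ p : M, TangentSpace 𝓘(ℝ, E) p}
    (h : ∀ x₀, ContMDiffAt 𝓘(ℝ, E) 𝓘(ℝ, E) ∞ (fun p => chartFwd x₀ p (X p)) x₀) :
    IsSmoothField X := by
  intro x₀
  refine (Bundle.contMDiffAt_section (F := E) (E := (TangentSpace 𝓘(ℝ, E) : M → Type _)) x₀).2 ?_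
  refine (h x₀).congr_of_eventuallyEq ?_
  filter_upwards [extChartAt_source_mem_nhds (I := 𝓘(ℝ, E)) x₀] with p hp
  have hp' : p ∈ (chartAt E x₀).source := by simpa using hp
  have h1 := TangentBundle.continuousLinearMapAt_trivializationAt (I := 𝓘(ℝ, E)) hp'
  have h2 := congrArg (fun T : E →L[ℝ] E => T (X p)) h1
  refine Eq.trans ?_ h2
  have hb : p ∈ (trivializationAt E (TangentSpace 𝓘(ℝ, E)) x₀).baseSet := hp'
  exact (congrFun ((trivializationAt E (TangentSpace 𝓘(ℝ, E)) x₀).coe_linearMapAt_of_mem (R := ℝ) hb) (X p)).symm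

end Families

/-! ### The action of the group on the homogeneous space -/

section One

variable {E E' G : Type*} [NormedAddCommGroup E] [NormedSpace ℝ E]
  [NormedAddCommGroup E'] [NormedSpace ℝ E'] [Group G] [TopologicalSpace G] [ChartedSpace E G]
  {K : Subgroup G} [ChartedSpace E' (G ⧸ K)]

theorem actDeriv_one (p : G ⧸ K) (ξ : TangentSpace 𝓘(ℝ, E') p) : (actDeriv (1 : G) p ξ : E') = ξ := by
  have h2 : (fun p : G ⧸ K => (1 : G) • p) = id := by funext p; exact one_smul G p
  have h1 : HasMFDerivAt 𝓘(ℝ, E') 𝓘(ℝ, E') (fun p : G ⧸ K => (1 : G) • p) p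
      (ContinuousLinearMap.id ℝ E') := by
    rw [h2]; exact hasMFDerivAt_id p
  exact congrArg (fun T : E' →L[ℝ] E' => T ξ) h1.mfderiv

theorem transport_one (v : GroupLieAlgebra 𝓘(ℝ, E) G) :
    transport (E' := E') K 1 v = projDeriv K v :=
  actDeriv_one _ _

end One

section Translations

variable {E G : Type*} [NormedAddCommGroup E] [NormedSpace ℝ E]
  [Group G] [TopologicalSpace G] [ChartedSpace E G] [LieGroup 𝓘(ℝ, E) ∞ G]

theorem mdifferentiableAt_mul_left (g h : G) : MDifferentiableAt 𝓘(ℝ, E) 𝓘(ℝ, E) (g * ·) h :=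
  (contMDiff_mul_left (n := ∞)).mdifferentiable (by simp) h

/-- The differentials of left translations are bijective. -/
theorem mulInvariantVectorField_bijective (g : G) :
    Function.Bijective (fun v : GroupLieAlgebra 𝓘(ℝ, E) G => mulInvariantVectorField v g) := by
  have key : ∀ (a b : G), b * a = 1 → ∀ v : E,
      (mfderiv 𝓘(ℝ, E) 𝓘(ℝ, E) (b * ·) a : E → E) ((mfderiv 𝓘(ℝ, E) 𝓘(ℝ, E) (a * ·) 1 : E → E) v) = v ∧
      (mfderiv 𝓘(ℝ, E) 𝓘(ℝ, E) (a * ·) 1 : E → E) ((mfderiv 𝓘(ℝ, E) 𝓘(ℝ, E) (b * ·) a : E → E) v) = v := by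
    intro a b hba v
    constructor
    · have h := HasMFDerivAt.comp (g := fun x : G => b * x) (f := fun x : G => a * x) 1
        (mdifferentiableAt_mul_left (E := E) b (a * 1)).hasMFDerivAt
        (mdifferentiableAt_mul_left (E := E) a 1).hasMFDerivAt
      have hid : (fun x : G => b * x) ∘ (fun x : G => a * x) = id := by
        funext x; simp [← mul_assoc, hba]
      rw [hid] at h
      have h2 := hasMFDerivAt_unique h (hasMFDerivAt_id 1)
      have h3 := congrArg (fun T : E →L[ℝ] E => T v) h2
      rw [mul_one] at h3
      exact h3
    · have h := HasMFDerivAt.comp (g := fun x : G => a * x) (f := fun x : G => b * x) a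
        (mdifferentiableAt_mul_left (E := E) a (b * a)).hasMFDerivAt
        (mdifferentiableAt_mul_left (E := E) b a).hasMFDerivAt
      have hab : a * b = 1 := mul_eq_one_comm.1 hba
      have hid : (fun x : G => a * x) ∘ (fun x : G => b * x) = id := by
        funext x; simp [← mul_assoc, hab]
      rw [hid] at h
      have h2 := hasMFDerivAt_unique h (hasMFDerivAt_id a)
      have h3 := congrArg (fun T : E →L[ℝ] E => T v) h2
      rw [hba] at h3
      exact h3
  refine Function.bijective_iff_has_inverse.2
    ⟨fun w => mfderiv 𝓘(ℝ, E) 𝓘(ℝ, E) (g⁻¹ * ·) g w, fun v => (key g g⁻¹ (by simp) v).1,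
      fun v => (key g g⁻¹ (by simp) v).2⟩

end Translations

section Action

universe u v

variable {E : Type v} {E' : Type u} {G : Type*}
  [NormedAddCommGroup E] [NormedSpace ℝ E] [CompleteSpace E]
  [NormedAddCommGroup E'] [NormedSpace ℝ E'] [CompleteSpace E']
  [Group G] [TopologicalSpace G] [ChartedSpace E G] [LieGroup 𝓘(ℝ, E) ∞ G]
  {K : Subgroup G} [ChartedSpace E' (G ⧸ K)] [IsManifold 𝓘(ℝ, E') ∞ (G ⧸ K)]

/-- `α_g ∘ π = π ∘ L_g` is smooth, and smoothness descends along `π`. -/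
theorem contMDiff_smul_coset (hπ : IsSubmersion E E' (fun g : G => (g : G ⧸ K))) (g : G) :
    ContMDiff 𝓘(ℝ, E') 𝓘(ℝ, E') ∞ (fun p : G ⧸ K => g • p) := by
  have := topologicalGroup_of_lieGroup 𝓘(ℝ, E) ∞ (G := G)
  intro p
  obtain ⟨h, rfl⟩ := QuotientGroup.mk_surjective p
  refine contMDiffAt_iff_target.2 ⟨(continuous_const_smul g).continuousAt, ?_⟩
  refine hπ.contMDiffAt_of_comp ?_
  have h1 : ContMDiffAt 𝓘(ℝ, E) 𝓘(ℝ, E') ∞ (fun x : G => ((g * x : G) : G ⧸ K)) h :=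
    (hπ.smooth (g * h)).comp h (contMDiff_mul_left (n := ∞) h)
  exact (contMDiffAt_extChartAt (I := 𝓘(ℝ, E')) (x := ((g * h : G) : G ⧸ K))).comp h h1

/-- As a single differential at `1`, `transport` visibly depends smoothly on `g` and can be compared
for two representatives of a coset. -/
theorem transport_apply (hπ : IsSubmersion E E' (fun g : G => (g : G ⧸ K)))
    (g : G) (v : GroupLieAlgebra 𝓘(ℝ, E) G) :
    transport (E' := E') K g v =
      mfderiv 𝓘(ℝ, E) 𝓘(ℝ, E') (fun h : G => ((g * h : G) : G ⧸ K)) 1 v := by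
  have h := HasMFDerivAt.comp (g := fun p : G ⧸ K => g • p) (f := fun x : G => (x : G ⧸ K)) 1
    (((contMDiff_smul_coset hπ g).mdifferentiable (by simp)) ((1 : G) : G ⧸ K)).hasMFDerivAt
    (hπ.smooth.mdifferentiable (by simp) 1).hasMFDerivAt
  exact congrArg (fun T : E →L[ℝ] E' => T v) h.mfderiv.symm

/-- Both sides differentiate `h ↦ ghK` at `1`, once as `π ∘ L_g` and once as `α_g ∘ π`. -/
theorem mfderiv_mulInvariantVectorField (hπ : IsSubmersion E E' (fun g : G => (g : G ⧸ K)))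
    (g : G) (v : GroupLieAlgebra 𝓘(ℝ, E) G) :
    mfderiv 𝓘(ℝ, E) 𝓘(ℝ, E') (fun h : G => (h : G ⧸ K)) g (mulInvariantVectorField v g) =
      transport (E' := E') K g v := by
  have h := HasMFDerivAt.comp (g := fun x : G => (x : G ⧸ K)) (f := fun x : G => g * x) 1
    (hπ.smooth.mdifferentiable (by simp) (g * 1)).hasMFDerivAt
    (mdifferentiableAt_mul_left (E := E) g 1).hasMFDerivAt
  have h1 : ∀ x, x = g → (mfderiv 𝓘(ℝ, E) 𝓘(ℝ, E') (fun h : G => (h : G ⧸ K)) x : E → E')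
      (mulInvariantVectorField v g) = mfderiv 𝓘(ℝ, E) 𝓘(ℝ, E') (fun h : G => (h : G ⧸ K)) g
        (mulInvariantVectorField v g) := by
    rintro _ rfl; rfl
  refine Eq.trans ?_ (transport_apply hπ g v).symm
  exact (h1 _ (mul_one g)).symm.trans (congrArg (fun T : E →L[ℝ] E' => T v) h.mfderiv.symm)

theorem transport_surjective (hπ : IsSubmersion E E' (fun g : G => (g : G ⧸ K)))
    (g : G) : Function.Surjective (transport (E := E) (E' := E') K g) := by
  intro w
  obtain ⟨u, hu⟩ := hπ.surjective g w
  obtain ⟨v, rfl⟩ := (mulInvariantVectorField_bijective g).2 u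
  exact ⟨v, (mfderiv_mulInvariantVectorField hπ g v).symm.trans hu⟩

/-- `(α_g)_* (α_h)_* = (α_{gh})_*`. -/
theorem actDeriv_actDeriv (hπ : IsSubmersion E E' (fun g : G => (g : G ⧸ K)))
    (g h : G) (p : G ⧸ K) (ξ : TangentSpace 𝓘(ℝ, E') p) :
    (actDeriv g (h • p) (actDeriv h p ξ) : E') = actDeriv (g * h) p ξ := by
  have h1 := HasMFDerivAt.comp (g := fun p : G ⧸ K => g • p) (f := fun p : G ⧸ K => h • p) p
    (((contMDiff_smul_coset hπ g).mdifferentiable (by simp)) (h • p)).hasMFDerivAt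
    (((contMDiff_smul_coset hπ h).mdifferentiable (by simp)) p).hasMFDerivAt
  have h2 : (fun p : G ⧸ K => g • p) ∘ (fun p : G ⧸ K => h • p) = fun p => (g * h) • p := by
    funext p; exact (mul_smul g h p).symm
  rw [h2] at h1
  exact congrArg (fun T : E' →L[ℝ] E' => T ξ) h1.mfderiv.symm

theorem actDeriv_transport (hπ : IsSubmersion E E' (fun g : G => (g : G ⧸ K)))
    (g h : G) (v : GroupLieAlgebra 𝓘(ℝ, E) G) :
    (actDeriv g (h : G ⧸ K) (transport (E' := E') K h v) : E') = transport (E' := E') K (g * h) v := by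
  refine Eq.trans ?_ (actDeriv_actDeriv hπ g h ((1 : G) : G ⧸ K) (projDeriv K v))
  have h1 : ∀ x, x = h → (actDeriv g ((h : G) : G ⧸ K) : E' → E') (transport (E' := E') K h v) =
      (actDeriv g ((x : G) : G ⧸ K) : E' → E') (transport (E' := E') K h v) := by
    rintro _ rfl; rfl
  exact h1 _ (mul_one h)

theorem actDeriv_eq_zero (hπ : IsSubmersion E E' (fun g : G => (g : G ⧸ K)))
    {g : G} {p : G ⧸ K} {ξ : TangentSpace 𝓘(ℝ, E') p} (h : actDeriv g p ξ = 0) :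
    ξ = 0 := by
  have h1 := actDeriv_actDeriv hπ g⁻¹ g p ξ
  rw [h, inv_mul_cancel] at h1
  exact (actDeriv_one p ξ).symm.trans (h1.symm.trans (map_zero _))

theorem transport_eq_zero_iff (hπ : IsSubmersion E E' (fun g : G => (g : G ⧸ K)))
    (g : G) (v : GroupLieAlgebra 𝓘(ℝ, E) G) :
    transport (E' := E') K g v = 0 ↔ projDeriv (E' := E') K v = 0 := by
  refine ⟨fun h => actDeriv_eq_zero hπ h, fun h => ?_⟩
  exact (congrArg (actDeriv g ((1 : G) : G ⧸ K)) h).trans (map_zero _)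

/-- The cosets `gkhK` and `g(khk⁻¹)K` coincide; differentiate in `h` at `1`. -/
theorem transport_mul_of_mem (hπ : IsSubmersion E E' (fun g : G => (g : G ⧸ K)))
    (g : G) {k : G} (hk : k ∈ K) (v : GroupLieAlgebra 𝓘(ℝ, E) G) :
    (transport (E' := E') K (g * k) v : E') = transport (E' := E') K g (Ad k v) := by
  have hc : MDifferentiableAt 𝓘(ℝ, E) 𝓘(ℝ, E) (fun h : G => k * h * k⁻¹) 1 :=
    (((contMDiff_mul_left (n := ∞) (a := k)).mul contMDiff_const).mdifferentiable (by simp)) 1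
  have hg : ∀ x, MDifferentiableAt 𝓘(ℝ, E) 𝓘(ℝ, E') (fun h : G => ((g * h : G) : G ⧸ K)) x :=
    fun x => (hπ.smooth.comp (contMDiff_mul_left (n := ∞) (a := g))).mdifferentiable (by simp) x
  have h1 := HasMFDerivAt.comp (g := fun h : G => ((g * h : G) : G ⧸ K))
    (f := fun h : G => k * h * k⁻¹) 1 (hg _).hasMFDerivAt hc.hasMFDerivAt
  have h2 : (fun h : G => ((g * h : G) : G ⧸ K)) ∘ (fun h : G => k * h * k⁻¹) =
      fun h => ((g * k * h : G) : G ⧸ K) := by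
    funext h
    refine QuotientGroup.eq.2 ?_
    simpa [mul_assoc] using hk
  rw [h2] at h1
  have h3 := congrArg (fun T : E →L[ℝ] E' => T v) h1.mfderiv
  have h4 : ∀ x, x = 1 →
      (mfderiv 𝓘(ℝ, E) 𝓘(ℝ, E') (fun h : G => ((g * h : G) : G ⧸ K)) x : E → E') (Ad k v) =
      mfderiv 𝓘(ℝ, E) 𝓘(ℝ, E') (fun h : G => ((g * h : G) : G ⧸ K)) 1 (Ad k v) := by
    rintro _ rfl; rfl
  exact (transport_apply hπ (g * k) v).trans (h3.trans ((h4 (k * 1 * k⁻¹) (by simp)).trans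
    (transport_apply hπ g (Ad k v)).symm))

end Action

/-! ### The homogeneous operator induced by an admissible operator -/

section Induced

universe u v

variable {E : Type v} {E' : Type u} {G : Type*}
  [NormedAddCommGroup E] [NormedSpace ℝ E] [CompleteSpace E]
  [NormedAddCommGroup E'] [NormedSpace ℝ E'] [CompleteSpace E']
  [Group G] [TopologicalSpace G] [ChartedSpace E G] [LieGroup 𝓘(ℝ, E) ∞ G]
  {K : Subgroup G} [ChartedSpace E' (G ⧸ K)] [IsManifold 𝓘(ℝ, E') ∞ (G ⧸ K)]
  {A : GroupLieAlgebra 𝓘(ℝ, E) G →L[ℝ] GroupLieAlgebra 𝓘(ℝ, E) G}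

theorem contMDiffAt_chartFwd_transport (hπ : IsSubmersion E E' (fun g : G => (g : G ⧸ K)))
    (g₀ : G) : ContMDiffAt 𝓘(ℝ, E) 𝓘(ℝ, E →L[ℝ] E') ∞
      (fun g : G => ((chartFwd (g₀ : G ⧸ K) (g : G ⧸ K)).comp (transport K g) : E →L[ℝ] E')) g₀ := by
  have hf : ContMDiffAt (𝓘(ℝ, E).prod 𝓘(ℝ, E)) 𝓘(ℝ, E') ∞
      (Function.uncurry fun g h : G => ((g * h : G) : G ⧸ K)) (g₀, 1) :=
    (hπ.smooth _).comp _ (contMDiff_mul 𝓘(ℝ, E) ∞ _)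
  have h := contMDiffAt_chartFwd_mfderiv hf
  refine h.congr_of_eventuallyEq (Eventually.of_forall fun g => ContinuousLinearMap.ext fun v => ?_)
  have h1 : ∀ p q : G ⧸ K, p = g₀ → q = g → ∀ w : E',
      (chartFwd (g₀ : G ⧸ K) (g : G ⧸ K) : E' → E') w = (chartFwd p q : E' → E') w := by
    rintro _ _ rfl rfl w; rfl
  refine (congrArg (chartFwd (g₀ : G ⧸ K) (g : G ⧸ K) : E' → E') (transport_apply hπ g v)).trans ?_
  exact h1 _ _ (by rw [mul_one]) (by rw [mul_one]) _

/-- An operator on `𝔤` that is admissible for `K` induces operators on the tangent spaces of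
`G/K`. -/
theorem exists_forall_transport {F : Type*} [NormedAddCommGroup F] [NormedSpace ℝ F]
    [CompleteSpace F] [ChartedSpace F K] (hK : IsImmersion F E (Subtype.val : K → G))
    (hπ : IsSubmersion E E' (fun g : G => (g : G ⧸ K))) (hA : IsAdmissible F K A) :
    ∃ N : ∀ p : G ⧸ K, TangentSpace 𝓘(ℝ, E') p →L[ℝ] TangentSpace 𝓘(ℝ, E') p,
      ∀ (g : G) (v : GroupLieAlgebra 𝓘(ℝ, E) G),
        N (g : G ⧸ K) (transport K g v) = transport K g (A v) := by
  have h0 : ∀ (g : G) (v : GroupLieAlgebra 𝓘(ℝ, E) G),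
      transport (E' := E') K g v = 0 ↔ v ∈ lieSubalgebra F K := fun g v =>
    (transport_eq_zero_iff hπ g v).trans (mem_lieSubalgebra_iff hK hπ v).symm
  have hT : ∀ g : G, ∃ T : E' →L[ℝ] E', ∀ v : E,
      T ((transport K g : E →L[ℝ] E') v) = (transport K g : E →L[ℝ] E') ((A : E →L[ℝ] E) v) := by
    intro g
    let Q : E →L[ℝ] E' := transport K g
    let B : E →L[ℝ] E := A
    -- The kernel of `Q` is `𝔨`, and `A` preserves it.
    refine exists_comp_eq_of_ker_le (Q := Q) (transport_surjective hπ g) (Q.comp B) fun v hv => ?_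
    exact (h0 g (A v)).2 (hA.map_mem v ((h0 g v).1 hv))
  choose T hT using hT
  -- `N` is defined from one representative of each coset. For another one, `Ad` of an element of
  -- `K` intervenes; it commutes with `A` modulo `𝔨`, which `transport` kills.
  refine ⟨fun p => T p.out, fun g v => ?_⟩
  obtain ⟨k, hk⟩ := QuotientGroup.mk_out_eq_mul K g
  set g₀ := (g : G ⧸ K).out with hg₀
  have hg : g = g₀ * (k⁻¹ : K) := by rw [hk]; simp
  have hkm : ((k⁻¹ : K) : G) ∈ K := (k⁻¹).2
  have h1 : ∀ x, x = g₀ * (k⁻¹ : K) → ∀ v : E, (transport K x : E →L[ℝ] E') v =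
      (transport K g₀ : E →L[ℝ] E') ((Ad ((k⁻¹ : K) : G) : E →L[ℝ] E) v) := by
    rintro _ rfl v
    exact transport_mul_of_mem hπ g₀ hkm v
  have h2 := (h0 g₀ _).2 (hA.commute _ hkm v)
  have h3 : (transport K g₀ : E →L[ℝ] E') ((Ad ((k⁻¹ : K) : G) : E →L[ℝ] E) ((A : E →L[ℝ] E) v)) =
      (transport K g₀ : E →L[ℝ] E') ((A : E →L[ℝ] E) ((Ad ((k⁻¹ : K) : G) : E →L[ℝ] E) v)) :=
    sub_eq_zero.1 (((transport K g₀ : E →L[ℝ] E').map_sub _ _).symm.trans h2)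
  exact (congrArg (T g₀) (h1 g hg v)).trans ((hT g₀ _).trans (h3.symm.trans (h1 g hg (A v)).symm))

variable {N : ∀ p : G ⧸ K, TangentSpace 𝓘(ℝ, E') p →L[ℝ] TangentSpace 𝓘(ℝ, E') p}

theorem contMDiffAt_chartOp_of_transport (hπ : IsSubmersion E E' (fun g : G => (g : G ⧸ K)))
    (hN : ∀ (g : G) (v : GroupLieAlgebra 𝓘(ℝ, E) G),
      N (g : G ⧸ K) (transport K g v) = transport K g (A v)) (p : G ⧸ K) :
    ContMDiffAt 𝓘(ℝ, E') 𝓘(ℝ, E' →L[ℝ] E') ∞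
      (fun q => chartOp N p (extChartAt 𝓘(ℝ, E') p q)) p := by
  obtain ⟨g, rfl⟩ := QuotientGroup.mk_surjective p
  exact hπ.contMDiffAt_chartOp (Q := fun g : G => transport K g) (A := A)
    (fun g => transport_surjective hπ g) hN (contMDiffAt_chartFwd_transport hπ g)

/-- The homogeneous bundle map induced by `A` is characterized by `N (α_g)_* π_* = (α_g)_* π_* A`. -/
theorem isInducedBy_iff_transport (hπ : IsSubmersion E E' (fun g : G => (g : G ⧸ K))) :
    IsInducedBy N A ↔ ∀ (g : G) (v : GroupLieAlgebra 𝓘(ℝ, E) G),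
      N (g : G ⧸ K) (transport K g v) = transport K g (A v) := by
  constructor
  · intro h g v
    have h1 := h.homogeneous.invariant g ((1 : G) : G ⧸ K) (projDeriv K v)
    rw [h.base] at h1
    have h2 : ∀ x : G, x = g → ∀ w : E', (N ((x : G) : G ⧸ K) : E' → E') w =
        (N (g : G ⧸ K) : E' → E') w := by
      rintro _ rfl w; rfl
    exact (h2 _ (mul_one g) _).symm.trans h1.symm
  · intro h
    refine ⟨⟨isSmoothBundleMap_of_contMDiffAt_chartOp
      (contMDiffAt_chartOp_of_transport hπ h), fun g p ξ => ?_⟩, fun v => ?_⟩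
    · obtain ⟨x, rfl⟩ := QuotientGroup.mk_surjective p
      obtain ⟨v, rfl⟩ := transport_surjective hπ x ξ
      refine (congrArg (actDeriv g (x : G ⧸ K)) (h x v)).trans ?_
      refine (actDeriv_transport hπ g x (A v)).trans ?_
      refine (h (g * x) v).symm.trans ?_
      exact congrArg (N ((g * x : G) : G ⧸ K)) (actDeriv_transport hπ g x v).symm
    · have h1 := h 1 v
      rw [transport_one, transport_one] at h1
      exact h1

end Induced

/-! ### The left-invariant operator on the group -/

section LeftInvariant

theorem isSubmersion_id {E M : Type*} [NormedAddCommGroup E] [NormedSpace ℝ E]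
    [TopologicalSpace M] [ChartedSpace E M] : IsSubmersion E E (id : M → M) :=
  ⟨contMDiff_id, fun x w => ⟨w, by rw [mfderiv_id]; rfl⟩⟩

variable {E : Type*} {G : Type*}
  [NormedAddCommGroup E] [NormedSpace ℝ E] [CompleteSpace E]
  [Group G] [TopologicalSpace G] [ChartedSpace E G] [LieGroup 𝓘(ℝ, E) ∞ G]

/-- Every operator on the Lie algebra extends to a left-invariant operator on the tangent spaces of
the group, smooth in charts. -/
theorem exists_leftInvariant (A : GroupLieAlgebra 𝓘(ℝ, E) G →L[ℝ] GroupLieAlgebra 𝓘(ℝ, E) G) :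
    ∃ N : ∀ g : G, TangentSpace 𝓘(ℝ, E) g →L[ℝ] TangentSpace 𝓘(ℝ, E) g,
      (∀ g v, N g (mulInvariantVectorField v g) = mulInvariantVectorField (A v) g) ∧
      ∀ g₀, ContMDiffAt 𝓘(ℝ, E) 𝓘(ℝ, E →L[ℝ] E) ∞
        (fun g => chartOp N g₀ (extChartAt 𝓘(ℝ, E) g₀ g)) g₀ := by
  have hT : ∀ g : G, ∃ T : E →L[ℝ] E, ∀ v : E,
      T ((mfderiv 𝓘(ℝ, E) 𝓘(ℝ, E) (g * ·) (1 : G) : E →L[ℝ] E) v) =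
        (mfderiv 𝓘(ℝ, E) 𝓘(ℝ, E) (g * ·) (1 : G) : E →L[ℝ] E) ((A : E →L[ℝ] E) v) := by
    intro g
    let Q : E →L[ℝ] E := mfderiv 𝓘(ℝ, E) 𝓘(ℝ, E) (g * ·) (1 : G)
    let B : E →L[ℝ] E := A
    have hb := mulInvariantVectorField_bijective (E := E) g
    refine exists_comp_eq_of_ker_le (Q := Q) hb.2 (Q.comp B) fun v hv => ?_
    have hv0 : v = 0 := hb.1 (hv.trans (map_zero Q).symm)
    rw [hv0, map_zero]
  choose T hT using hT
  refine ⟨T, hT, fun g₀ => ?_⟩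
  have hf : ContMDiffAt (𝓘(ℝ, E).prod 𝓘(ℝ, E)) 𝓘(ℝ, E) ∞
      (Function.uncurry fun g h : G => g * h) (g₀, 1) := contMDiff_mul 𝓘(ℝ, E) ∞ _
  have h := contMDiffAt_chartFwd_mfderiv hf
  -- Descent along the identity of `G` serves here to solve `N Q = Q A` smoothly for `N`.
  refine (isSubmersion_id (E := E)).contMDiffAt_chartOp (A := A)
    (Q := fun g : G => mfderiv 𝓘(ℝ, E) 𝓘(ℝ, E) (g * ·) (1 : G))
    (fun g => (mulInvariantVectorField_bijective (E := E) g).2) hT ?_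
  refine h.congr_of_eventuallyEq (Eventually.of_forall fun g => ContinuousLinearMap.ext fun v => ?_)
  have h1 : ∀ p q : G, p = g₀ → q = g → ∀ w : E,
      (chartFwd g₀ g : E → E) w = (chartFwd p q : E → E) w := by
    rintro _ _ rfl rfl w; rfl
  exact h1 _ _ (mul_one _) (mul_one _) _

/-- `N` and the bracket both preserve left-invariant fields, so every term is the left-invariant
field of an element of `𝔤`. -/
theorem nijenhuisTorsion_leftInvariant
    {A : GroupLieAlgebra 𝓘(ℝ, E) G →L[ℝ] GroupLieAlgebra 𝓘(ℝ, E) G}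
    {N : ∀ g : G, TangentSpace 𝓘(ℝ, E) g →L[ℝ] TangentSpace 𝓘(ℝ, E) g}
    (hN : ∀ g v, N g (mulInvariantVectorField v g) = mulInvariantVectorField (A v) g)
    (v w : GroupLieAlgebra 𝓘(ℝ, E) G) (g : G) :
    nijenhuisTorsion N (mulInvariantVectorField v) (mulInvariantVectorField w) g =
      mulInvariantVectorField (lieTorsion A v w) g := by
  have : LieGroup 𝓘(ℝ, E) (minSmoothness ℝ 3) G := by
    rw [minSmoothness_of_isRCLikeNormedField]; infer_instance
  have h1 : ∀ v : GroupLieAlgebra 𝓘(ℝ, E) G,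
      (fun q => N q (mulInvariantVectorField v q)) = mulInvariantVectorField (A v) :=
    fun v => funext fun q => hN q v
  have h2 : ∀ v w : GroupLieAlgebra 𝓘(ℝ, E) G, VectorField.mlieBracket 𝓘(ℝ, E)
      (mulInvariantVectorField v) (mulInvariantVectorField w) g =
        mulInvariantVectorField ⁅v, w⁆ g := fun v w =>
    (congrFun (mulInvariantVector_mlieBracket v w) g).symm
  rw [nijenhuisTorsion, h1, h1, h2, h2, h2, h2, hN, hN, hN, hN]
  let D : E →L[ℝ] E := mfderiv 𝓘(ℝ, E) 𝓘(ℝ, E) (g * ·) (1 : G)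
  -- The first two terms come in opposite orders in `nijenhuisTorsion` and `lieTorsion`.
  have h3 : ∀ a b c d : E, D b + D a - D c - D d = D (a + b - c - d) := fun a b c d => by
    rw [map_sub, map_sub, map_add, add_comm (D b)]
  exact h3 (A ⁅v, A w⁆) (A ⁅A v, w⁆) (⁅A v, A w⁆ : GroupLieAlgebra 𝓘(ℝ, E) G) (A (A ⁅v, w⁆))

end LeftInvariant

/-! ### Torsion on the homogeneous space -/

section HomogeneousTorsion

universe u v

variable {E : Type v} {E' : Type u} {G : Type*}
  [NormedAddCommGroup E] [NormedSpace ℝ E] [CompleteSpace E]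
  [NormedAddCommGroup E'] [NormedSpace ℝ E'] [CompleteSpace E']
  [Group G] [TopologicalSpace G] [ChartedSpace E G] [LieGroup 𝓘(ℝ, E) ∞ G]
  {K : Subgroup G} [ChartedSpace E' (G ⧸ K)] [IsManifold 𝓘(ℝ, E') ∞ (G ⧸ K)]
  {A : GroupLieAlgebra 𝓘(ℝ, E) G →L[ℝ] GroupLieAlgebra 𝓘(ℝ, E) G}

/-- The torsion of the homogeneous operator induced by `A` is induced by the torsion of `A`. -/
theorem nijenhuisTorsion_eq_transport (hπ : IsSubmersion E E' (fun g : G => (g : G ⧸ K)))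
    {N : ∀ p : G ⧸ K, TangentSpace 𝓘(ℝ, E') p →L[ℝ] TangentSpace 𝓘(ℝ, E') p}
    (hN : ∀ (g : G) (v : GroupLieAlgebra 𝓘(ℝ, E) G),
      N (g : G ⧸ K) (transport K g v) = transport K g (A v))
    {X Y : ∀ p : G ⧸ K, TangentSpace 𝓘(ℝ, E') p} (hX : IsSmoothField X) (hY : IsSmoothField Y)
    {g : G} {v w : GroupLieAlgebra 𝓘(ℝ, E) G} (hXv : X (g : G ⧸ K) = transport K g v)
    (hYw : Y (g : G ⧸ K) = transport K g w) :
    nijenhuisTorsion N X Y (g : G ⧸ K) = transport K g (lieTorsion A v w) := by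
  have : LieGroup 𝓘(ℝ, E) (minSmoothness ℝ 3) G := by
    rw [minSmoothness_of_isRCLikeNormedField]; infer_instance
  obtain ⟨B, hB, hBs⟩ := exists_leftInvariant A
  have hBN : ∀ (x : G) (u : TangentSpace 𝓘(ℝ, E) x),
      mfderiv 𝓘(ℝ, E) 𝓘(ℝ, E') (fun g : G => (g : G ⧸ K)) x (B x u) =
        N (x : G ⧸ K) (mfderiv 𝓘(ℝ, E) 𝓘(ℝ, E') (fun g : G => (g : G ⧸ K)) x u) := by
    intro x u
    obtain ⟨e, rfl⟩ := (mulInvariantVectorField_bijective x).2 u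
    refine (congrArg (mfderiv 𝓘(ℝ, E) 𝓘(ℝ, E') (fun g : G => (g : G ⧸ K)) x) (hB x e)).trans ?_
    refine (mfderiv_mulInvariantVectorField hπ x (A e)).trans ((hN x e).symm.trans ?_)
    exact congrArg (N (x : G ⧸ K)) (mfderiv_mulInvariantVectorField hπ x e).symm
  -- By tensoriality `X` and `Y` need not be lifted to `G`: left-invariant fields whose values at
  -- `g` project to those of `X` and `Y` suffice.
  have h := nijenhuisTorsion_natural hπ.smooth (x₀ := g) (differentiableAt_chartOp (hBs g))
    (differentiableAt_chartOp (contMDiffAt_chartOp_of_transport hπ hN g)) hBN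
    (mdifferentiableAt_mulInvariantVectorField v) (mdifferentiableAt_mulInvariantVectorField w)
    (hX.mdifferentiable (by simp) _) (hY.mdifferentiable (by simp) _)
    (hXv.trans (mfderiv_mulInvariantVectorField hπ g v).symm)
    (hYw.trans (mfderiv_mulInvariantVectorField hπ g w).symm)
  refine h.trans ?_
  rw [nijenhuisTorsion_leftInvariant hB]
  exact mfderiv_mulInvariantVectorField hπ g _

/-- Every vector in the Lie algebra is realized at the base point by a smooth vector field on
`G/K`, the fundamental field of the action. -/
theorem exists_isSmoothField_projDeriv (hπ : IsSubmersion E E' (fun g : G => (g : G ⧸ K)))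
    (v : GroupLieAlgebra 𝓘(ℝ, E) G) :
    ∃ X : ∀ p : G ⧸ K, TangentSpace 𝓘(ℝ, E') p, IsSmoothField X ∧
      X ((1 : G) : G ⧸ K) = projDeriv K v := by
  let X : ∀ p : G ⧸ K, TangentSpace 𝓘(ℝ, E') p := fun p =>
    (mfderiv 𝓘(ℝ, E) 𝓘(ℝ, E') (fun h : G => h • p) 1 : E → E') v
  refine ⟨X, isSmoothField_of_contMDiffAt_chartFwd fun p => ?_, ?_⟩
  · obtain ⟨g₀, rfl⟩ := QuotientGroup.mk_surjective p
    -- Pulled back to `G`, the field is the differential at `h = 1` of `h ↦ hgK`, which depends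
    -- smoothly on `g`.
    refine hπ.contMDiffAt_of_comp ?_
    have hf : ContMDiffAt (𝓘(ℝ, E).prod 𝓘(ℝ, E)) 𝓘(ℝ, E') ∞
        (Function.uncurry fun g h : G => ((h * g : G) : G ⧸ K)) (g₀, 1) :=
      (hπ.smooth _).comp _ ((contMDiff_snd.mul contMDiff_fst :
        ContMDiff (𝓘(ℝ, E).prod 𝓘(ℝ, E)) 𝓘(ℝ, E) ∞ fun x : G × G => x.2 * x.1) _)
    have hv : ContDiff ℝ ∞ (fun T : E →L[ℝ] E' => T (v : E)) := by fun_prop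
    have h := hv.contMDiff.contMDiffAt.comp g₀ (contMDiffAt_chartFwd_mfderiv hf)
    refine h.congr_of_eventuallyEq (Eventually.of_forall fun g => ?_)
    have h1 : ∀ p q : G ⧸ K, p = g₀ → q = g → ∀ w : E',
        (chartFwd (g₀ : G ⧸ K) (g : G ⧸ K) : E' → E') w = (chartFwd p q : E' → E') w := by
      rintro _ _ rfl rfl w; rfl
    exact h1 _ _ (by rw [one_mul]) (by rw [one_mul]) _
  · have h1 : ∀ f : G → G ⧸ K, f = (fun h : G => (h : G ⧸ K)) →
        (mfderiv 𝓘(ℝ, E) 𝓘(ℝ, E') f 1 : E → E') v =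
          (mfderiv 𝓘(ℝ, E) 𝓘(ℝ, E') (fun h : G => (h : G ⧸ K)) 1 : E → E') v := by
      rintro _ rfl; rfl
    exact h1 _ (funext fun h => congrArg QuotientGroup.mk (mul_one h))

end HomogeneousTorsion

end BanachHomogeneous

open BanachHomogeneous
theorem theorem3p4
    -- the Banach-Lie group `G`, modelled on the Banach space `E`
    {E : Type*} [NormedAddCommGroup E] [NormedSpace ℝ E] [CompleteSpace E]
    {G : Type*} [Group G] [TopologicalSpace G] [ChartedSpace E G] [LieGroup 𝓘(ℝ, E) ∞ G]
    -- the embedded Banach-Lie subgroup `K` (with the subspace topology), modelled on `F`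
    {F : Type*} [NormedAddCommGroup F] [NormedSpace ℝ F] [CompleteSpace F]
    (K : Subgroup G) [ChartedSpace F K] [LieGroup 𝓘(ℝ, F) ∞ K]
    (hK : IsImmersion F E (Subtype.val : K → G))
    -- the homogeneous space `G/K`: a Hausdorff Banach manifold with `π` a submersion
    {E' : Type*} [NormedAddCommGroup E'] [NormedSpace ℝ E'] [CompleteSpace E']
    [T2Space (G ⧸ K)] [ChartedSpace E' (G ⧸ K)] [IsManifold 𝓘(ℝ, E') ∞ (G ⧸ K)]
    (hπ : IsSubmersion E E' (fun g : G => (g : G ⧸ K)))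
    -- the admissible operator
    (A : GroupLieAlgebra 𝓘(ℝ, E) G →L[ℝ] GroupLieAlgebra 𝓘(ℝ, E) G)
    (hA : IsAdmissible F K A) :
    (∃! N : ∀ p : G ⧸ K, TangentSpace 𝓘(ℝ, E') p →L[ℝ] TangentSpace 𝓘(ℝ, E') p,
      IsInducedBy N A) ∧
    ∀ N : ∀ p : G ⧸ K, TangentSpace 𝓘(ℝ, E') p →L[ℝ] TangentSpace 𝓘(ℝ, E') p,
      IsInducedBy N A →
      (∀ X Y : ∀ p : G ⧸ K, TangentSpace 𝓘(ℝ, E') p, IsSmoothField X → IsSmoothField Y →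
        ∀ (g : G) (v w : GroupLieAlgebra 𝓘(ℝ, E) G),
          X (g : G ⧸ K) = transport K g v → Y (g : G ⧸ K) = transport K g w →
          nijenhuisTorsion N X Y (g : G ⧸ K) = transport K g (lieTorsion A v w)) ∧
      (IsNijenhuis N ↔
        ∀ v w : GroupLieAlgebra 𝓘(ℝ, E) G, lieTorsion A v w ∈ lieSubalgebra F K) := by
  have huniq : ∀ N₁ N₂ : ∀ p : G ⧸ K, TangentSpace 𝓘(ℝ, E') p →L[ℝ] TangentSpace 𝓘(ℝ, E') p,
      IsInducedBy N₁ A → IsInducedBy N₂ A → N₁ = N₂ := by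
    intro N₁ N₂ h₁ h₂
    funext p
    obtain ⟨g, rfl⟩ := QuotientGroup.mk_surjective p
    refine ContinuousLinearMap.ext fun ξ => ?_
    obtain ⟨v, rfl⟩ := transport_surjective hπ g ξ
    exact ((isInducedBy_iff_transport hπ).1 h₁ g v).trans
      ((isInducedBy_iff_transport hπ).1 h₂ g v).symm
  obtain ⟨N₀, hN₀⟩ := exists_forall_transport hK hπ hA
  have hN₀' := (isInducedBy_iff_transport hπ).2 hN₀
  refine ⟨⟨N₀, hN₀', fun N hN => huniq N N₀ hN hN₀'⟩, fun N hN => ?_⟩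
  have hNt := (isInducedBy_iff_transport hπ).1 hN
  refine ⟨fun X Y hX hY g v w hXv hYw => nijenhuisTorsion_eq_transport hπ hNt hX hY hXv hYw,
    fun h v w => ?_, fun h X Y hX hY p => ?_⟩
  -- The base point suffices: fundamental fields realize every pair `v`, `w` there.
  · obtain ⟨X, hX, hXv⟩ := exists_isSmoothField_projDeriv hπ v
    obtain ⟨Y, hY, hYw⟩ := exists_isSmoothField_projDeriv hπ w
    have ht := nijenhuisTorsion_eq_transport hπ hNt hX hY (hXv.trans (transport_one v).symm)
      (hYw.trans (transport_one w).symm)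
    rw [mem_lieSubalgebra_iff hK hπ, ← transport_eq_zero_iff hπ 1]
    exact ht.symm.trans (h X Y hX hY _)
  · obtain ⟨g, rfl⟩ := QuotientGroup.mk_surjective p
    obtain ⟨v, hv⟩ := transport_surjective hπ g (X g)
    obtain ⟨w, hw⟩ := transport_surjective hπ g (Y g)
    refine (nijenhuisTorsion_eq_transport hπ hNt hX hY hv.symm hw.symm).trans ?_
    exact (transport_eq_zero_iff hπ g _).2 ((mem_lieSubalgebra_iff hK hπ _).1 (h v w))
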